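/- **Model.** Time is slotted, $t=0,\dots,T-1$. In each slot the source is idle, sends a fresh packet directly to the user (user update), or sends a fresh packet to the cache (cache update). A schedule (deterministic policy; the source receives no feedback) is feasible if it uses at most $T_1$ user updates and at most $T_2$ cache updates, and there is at least one cache update between any two user updates; here $T_1+T_2<T$. A randomized policy $\pi$ is a probability distribution on feasible schedules. An oblivious adversary fixes $\sigma\in\{0,1\}^T$. In slot $t$, if the source updates the user, the user holds the packet generated at $t$; otherwise, if $\sigma(t)=1$, the user's packet is replaced by the packet in the cache (which is the packet generated at $t$ if the cache is updated in slot $t$); otherwise the user keeps its packet. If $u(t)$ is the generation time of the packet the user holds before slot $t$, the age is $v(t)=t-u(t)$; at the start, the user and the cache hold packets generated at time $-1$. Let $A^{\pi,\sigma}=\frac1T\sum_{t=0}^{T-1}\mathbb E_\pi[v^{\pi,\sigma}(t)]$, let $A^{o,\sigma}$ be the minimum of $A^{p,\sigma}$ over feasible schedules $p$ (chosen knowing $\sigma$), and let $c^\pi=\max_\sigma A^{\pi,\sigma}/A^{o,\sigma}$. Let $P_1$ be the law of $T$ i.i.d. uniform bits. **Regime.** Fix integers $x_2,x_3\ge1$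 and, for $n\in\mathbb N$, put $T_1=n$, $T_2=x_3n$, $T=n+x_2(x_3n+1)$, so that $x_2=\frac{T-T_1}{T_2+1}$, $x_3=\frac{T_2}{T_1}$ (for $n\ge 1$). Divide the horizon into $T_2+1$ consecutive sections, section $i\le T_2$ having $x_2+1$ slots if $x_3\mid i$ and $x_2$ slots otherwise, and the last section having $x_2$ slots. The schedule $\check\pi$ updates the cache in the last slot of sections $1,\dots,T_2$, and the user in the last but one slot of sections $x_3,2x_3,\dots,T_1x_3$. The offline policy $\check\pi_1$ has the same user updates, but puts off each cache update from its slot $s$ to the first slot $t\in\{s,\dots,s+x_2-1\}$ with $\sigma(t)=1$ (to $s+x_2-1$ if there is none). Let $$N=\frac{x_3x_2(x_2-1)}2+2x_2x_3+2-\frac1{2^{x_2x_3}}+\frac{x_22^{x_2}}{2^{x_2}-1}\Big(\frac1{2^{x_2x_3}}-1\Big),$$ $$D=3-\frac{2x_3}{2^{x_2}}+2x_3+x_2-\frac2{2^{x_2x_3}}+\frac{x_3x_2(x_2-3)}2+2x_3x_2+\frac{x_2(2^{x_2}+1)}{2^{x_2x_3}(2^{x_2}-1)}-\frac{2x_22^{x_2}}{2^{x_2}-1}.$$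 **Theorem.** 1. For all $T,T_1,T_2$ with $T_1+T_2<T$, every randomized policy satisfies $c^\pi\ge \min_{p}\mathbb E_{\sigma\sim P_1}[A^{p,\sigma}]\,/\,\mathbb E_{\sigma\sim P_1}[A^{o,\sigma}]$, the minimum being over feasible schedules $p$. In the regime above, as $n\to\infty$ (that is, for large $T$): 2. $\check\pi$ is feasible and asymptotically the best deterministic policy: $\mathbb E_{P_1}[A^{\check\pi,\sigma}]-\min_p\mathbb E_{P_1}[A^{p,\sigma}]\to0$. 3. $\mathbb E_{P_1}[A^{\check\pi,\sigma}]-\frac{T_1}T N\to0$. 4. $\check\pi_1$ is feasible for every $\sigma$, and $\mathbb E_{P_1}[A^{\check\pi_1,\sigma}]-\frac{T_1}T D\to0$; hence for every $\varepsilon>0$ and all large $n$, $\mathbb E_{P_1}[A^{o,\sigma}]\le\frac{T_1}TD+\varepsilon$. 5. $D>0$, and for every $\varepsilon>0$ and all large $n$, every randomized policy $\pi$ satisfies $$c^\pi\ \ge\ \frac{\mathbb E_{P_1}[A^{\check\pi,\sigma}]}{\mathbb E_{P_1}[A^{o,\sigma}]}-\varepsilon\qquad\text{and}\qquad c^\pi\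 \ge\ \frac ND-\varepsilon .$$ -/

import Mathlib

open Filter Topology

namespace CacheAge

/-- What the source does in one slot: nothing, a direct update of the user, or an update of the
cache. -/
inductive SourceAction where
  | idle
  | user
  | cache
  deriving DecidableEq

instance : Fintype SourceAction where
  elems := {SourceAction.idle, SourceAction.user, SourceAction.cache}
  complete a := by cases a <;> simp

/-- A deterministic transmission policy over `T` slots (the source gets no feedback, so that it is
a fixed schedule). -/
abbrev Schedule (T : ℕ) := Fin T → SourceAction

/-- An action sequence of the oblivious adversary; `true` (action `1`): the cached packet is
forwarded to the user, stamped with the current time; `false` (action `0`): it is stamped as stalest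
possible, so that the user rejects it. -/
abbrev AdvSeq (T : ℕ) := Fin T → Bool

/-- A schedule respects the budgets of `T₁` user updates and `T₂` cache updates, and updates the
user at most once between consecutive cache updates. -/
def Feasible {T : ℕ} (T₁ T₂ : ℕ) (p : Schedule T) : Prop :=
  (Finset.univ.filter fun t => p t = SourceAction.user).card ≤ T₁ ∧
  (Finset.univ.filter fun t => p t = SourceAction.cache).card ≤ T₂ ∧
  ∀ s t : Fin T, s < t → p s = SourceAction.user → p t = SourceAction.user →
    ∃ r, s < r ∧ r < t ∧ p r = SourceAction.cache

/-- The (true) generation times of the packets held by the user (first component) and by the cache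
(second component) before slot `t`. In slot `t` a cache update arrives before the adversary acts, a
forwarded packet is always accepted, and a direct update from the source prevails over it. Both
initial packets were generated at time `-1`. -/
def packets {T : ℕ} (p : Schedule T) (σ : AdvSeq T) : ℕ → ℤ × ℤ
  | 0 => (-1, -1)
  | t + 1 =>
    if h : t < T then
      let c : ℤ := if p ⟨t, h⟩ = SourceAction.cache then (t : ℤ) else (packets p σ t).2
      let u : ℤ :=
        if p ⟨t, h⟩ = SourceAction.user then (t : ℤ)
        else if σ ⟨t, h⟩ = true then c
        else (packets p σ t).1
      (u, c)
    else packets p σ t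

/-- The age of the user in slot `t`. -/
def age {T : ℕ} (p : Schedule T) (σ : AdvSeq T) (t : Fin T) : ℤ :=
  (t : ℤ) - (packets p σ t).1

noncomputable section

/-- Average age of a deterministic policy. -/
def avgAge {T : ℕ} (p : Schedule T) (σ : AdvSeq T) : ℝ :=
  (1 / (T : ℝ)) * ∑ t : Fin T, (age p σ t : ℝ)

/-- Average age of a randomized policy, the mean being over the policy's own randomness. -/
def randAvgAge {T : ℕ} (π : PMF (Schedule T)) (σ : AdvSeq T) : ℝ :=
  (1 / (T : ℝ)) * ∑ t : Fin T, ∑ p : Schedule T, (π p).toReal * (age p σ t : ℝ)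

/-- Average age of the offline optimum, which knows `σ` in advance. -/
def offlineAge {T : ℕ} (T₁ T₂ : ℕ) (σ : AdvSeq T) : ℝ :=
  ⨅ p : {p : Schedule T // Feasible T₁ T₂ p}, avgAge p.1 σ

/-- Competitive ratio of a randomized policy. -/
def competitiveRatio {T : ℕ} (T₁ T₂ : ℕ) (π : PMF (Schedule T)) : ℝ :=
  ⨆ σ : AdvSeq T, randAvgAge π σ / offlineAge T₁ T₂ σ

/-- Expectation over an adversarial sequence of i.i.d. uniform bits. -/
def fairExp {T : ℕ} (f : AdvSeq T → ℝ) : ℝ :=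
  ∑ σ : AdvSeq T, (∏ _t : Fin T, (1 / 2 : ℝ)) * f σ

/-- Least expected average age of a deterministic policy under the uniform adversary. -/
def bestDetAge (T T₁ T₂ : ℕ) : ℝ :=
  ⨅ p : {p : Schedule T // Feasible T₁ T₂ p}, fairExp (avgAge p.1)

end

/-- The horizon `T` with `T₁ = n`, `T₂ / T₁ = x₃` and `(T - T₁) / (T₂ + 1) = x₂`. -/
def horizon (x₂ x₃ n : ℕ) : ℕ := n + x₂ * (x₃ * n + 1)

/-- Number of slots in the first `i` sections: a section has `x₂` slots, and one more if its index
is a multiple of `x₃`. Section `i` thus ends with slot `sectionEnd x₂ x₃ i - 1`. -/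
def sectionEnd (x₂ x₃ i : ℕ) : ℕ := i * x₂ + i / x₃

/-- The slots of the direct updates: the last but one slot of each section whose index is a
multiple `m * x₃`, `1 ≤ m ≤ n`. -/
def IsUserSlot (x₂ x₃ n t : ℕ) : Prop :=
  ∃ m ∈ Finset.Icc 1 n, t + 2 = sectionEnd x₂ x₃ (m * x₃)

instance (x₂ x₃ n t : ℕ) : Decidable (IsUserSlot x₂ x₃ n t) := by
  unfold IsUserSlot; infer_instance

/-- The slots of the cache updates: the last slot of section `i`, `1 ≤ i ≤ x₃ * n`. -/
def IsCacheSlot (x₂ x₃ n t : ℕ) : Prop :=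
  ∃ i ∈ Finset.Icc 1 (x₃ * n), t + 1 = sectionEnd x₂ x₃ i

instance (x₂ x₃ n t : ℕ) : Decidable (IsCacheSlot x₂ x₃ n t) := by
  unfold IsCacheSlot; infer_instance

/-- The schedule with `x₃ * n + 1` sections, a cache update in the last slot of each section but
the last one, and a direct update just before every `x₃`-th cache update. -/
def checkPolicy (x₂ x₃ n : ℕ) : Schedule (horizon x₂ x₃ n) := fun t =>
  if IsUserSlot x₂ x₃ n t then SourceAction.user
  else if IsCacheSlot x₂ x₃ n t then SourceAction.cache
  else SourceAction.idle

/-- The cache update slots of an offline variant: the `i`-th cache update is put off from the last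
slot of section `i` to the first slot, from there on, in which the adversary forwards the cached
packet, but at most by `x₂ - 1` slots (before the next update slot of `checkPolicy`). -/
def IsDelayedCacheSlot (x₂ x₃ n : ℕ) {T : ℕ} (σ : AdvSeq T) (t : Fin T) : Prop :=
  ∃ i ∈ Finset.Icc 1 (x₃ * n),
    sectionEnd x₂ x₃ i ≤ (t : ℕ) + 1 ∧ (t : ℕ) + 1 < sectionEnd x₂ x₃ i + x₂ ∧
    (∀ s : Fin T, sectionEnd x₂ x₃ i ≤ (s : ℕ) + 1 → s < t → σ s = false) ∧
    (σ t = true ∨ (t : ℕ) + 2 = sectionEnd x₂ x₃ i + x₂)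

instance (x₂ x₃ n : ℕ) {T : ℕ} (σ : AdvSeq T) (t : Fin T) :
    Decidable (IsDelayedCacheSlot x₂ x₃ n σ t) := by
  unfold IsDelayedCacheSlot; infer_instance

/-- The offline variant of `checkPolicy` with delayed cache updates. -/
def offlineCheckPolicy (x₂ x₃ n : ℕ) (σ : AdvSeq (horizon x₂ x₃ n)) :
    Schedule (horizon x₂ x₃ n) := fun t =>
  if IsUserSlot x₂ x₃ n t then SourceAction.user
  else if IsDelayedCacheSlot x₂ x₃ n σ t then SourceAction.cache
  else SourceAction.idle

noncomputable section

/-- Closed form of the expected age collected by `checkPolicy` per direct update. -/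
def onlineConst (x₂ x₃ : ℕ) : ℝ :=
  (x₃ : ℝ) * x₂ * ((x₂ : ℝ) - 1) / 2 + 2 * x₂ * x₃ + 2 - 1 / 2 ^ (x₂ * x₃)
    + (x₂ : ℝ) * 2 ^ x₂ / (2 ^ x₂ - 1) * (1 / 2 ^ (x₂ * x₃) - 1)

/-- Closed form of the expected age collected by `offlineCheckPolicy` per direct update. -/
def offlineConst (x₂ x₃ : ℕ) : ℝ :=
  3 - 2 * (x₃ : ℝ) / 2 ^ x₂ + 2 * x₃ + x₂ - 2 / 2 ^ (x₂ * x₃)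
    + (x₃ : ℝ) * x₂ * ((x₂ : ℝ) - 3) / 2 + 2 * x₃ * x₂
    + (x₂ : ℝ) * (2 ^ x₂ + 1) / (2 ^ (x₂ * x₃) * (2 ^ x₂ - 1))
    - 2 * (x₂ : ℝ) * 2 ^ x₂ / (2 ^ x₂ - 1)

end

end CacheAge

namespace CacheAge

/-! ### Expectations under the uniform adversary -/

theorem fairExp_eq {T : ℕ} (f : AdvSeq T → ℝ) :
    fairExp f = (1 / 2 : ℝ) ^ T * ∑ σ : AdvSeq T, f σ := by
  simp [fairExp, Finset.mul_sum]

theorem fairExp_const {T : ℕ} (c : ℝ) : fairExp (fun _ : AdvSeq T => c) = c := by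
  rw [fairExp_eq]
  simp only [Finset.sum_const, Finset.card_univ, Fintype.card_fun, Fintype.card_bool,
    Fintype.card_fin, nsmul_eq_mul]
  push_cast
  rw [← mul_assoc, ← mul_pow]
  norm_num

theorem fairExp_add {T : ℕ} (f g : AdvSeq T → ℝ) :
    fairExp (fun σ => f σ + g σ) = fairExp f + fairExp g := by
  simp only [fairExp_eq, Finset.sum_add_distrib, mul_add]

theorem fairExp_const_mul {T : ℕ} (c : ℝ) (f : AdvSeq T → ℝ) :
    fairExp (fun σ => c * f σ) = c * fairExp f := by
  simp only [fairExp_eq, ← Finset.mul_sum]; ring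

theorem fairExp_sum {T : ℕ} {ι : Type*} (s : Finset ι) (f : ι → AdvSeq T → ℝ) :
    fairExp (fun σ => ∑ i ∈ s, f i σ) = ∑ i ∈ s, fairExp (f i) := by
  simp only [fairExp_eq]
  rw [Finset.sum_comm, Finset.mul_sum]

theorem fairExp_mono {T : ℕ} {f g : AdvSeq T → ℝ} (h : ∀ σ, f σ ≤ g σ) :
    fairExp f ≤ fairExp g := by
  simp only [fairExp_eq]
  gcongr with σ
  exact h σ

/-- Flips one bit of an adversarial sequence. -/
def flipAt {T : ℕ} (t : Fin T) (σ : AdvSeq T) : AdvSeq T := Function.update σ t (!σ t)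

theorem flipAt_same {T : ℕ} (t : Fin T) (σ : AdvSeq T) : flipAt t σ t = !σ t := by
  simp [flipAt]

theorem flipAt_of_ne {T : ℕ} {s t : Fin T} (h : s ≠ t) (σ : AdvSeq T) :
    flipAt t σ s = σ s := by
  simp [flipAt, h]

theorem flipAt_involutive {T : ℕ} (t : Fin T) : Function.Involutive (flipAt t) := by
  intro σ
  ext s
  by_cases h : s = t
  · subst h; simp [flipAt]
  · simp [flipAt, h]

theorem fairExp_flipAt {T : ℕ} (t : Fin T) (f : AdvSeq T → ℝ) :
    fairExp (fun σ => f (flipAt t σ)) = fairExp f := by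
  simp only [fairExp_eq]
  congr 1
  exact Equiv.sum_comp (flipAt_involutive t).toPerm f

/-- Conditioning on one bit that the two branches do not depend on. -/
theorem fairExp_ite {T : ℕ} (t : Fin T) (f g : AdvSeq T → ℝ)
    (hf : ∀ σ, f (flipAt t σ) = f σ) (hg : ∀ σ, g (flipAt t σ) = g σ) :
    fairExp (fun σ => if σ t = true then f σ else g σ) = (fairExp f + fairExp g) / 2 := by
  have h1 := fairExp_flipAt t (fun σ => if σ t = true then f σ else g σ)
  have h2 := fairExp_add (fun σ => if σ t = true then f σ else g σ)
    (fun σ => if flipAt t σ t = true then f (flipAt t σ) else g (flipAt t σ))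
  have h3 : (fun σ : AdvSeq T => (if σ t = true then f σ else g σ) +
      (if flipAt t σ t = true then f (flipAt t σ) else g (flipAt t σ))) =
      fun σ => f σ + g σ := by
    ext σ
    rw [flipAt_same, hf, hg]
    cases σ t <;> simp [add_comm]
  rw [h3, fairExp_add] at h2
  linarith

/-! ### The packet recursion -/

theorem packets_congr {T : ℕ} {p p' : Schedule T} {σ σ' : AdvSeq T} (t : ℕ)
    (hp : ∀ s : Fin T, (s : ℕ) < t → p s = p' s) (hσ : ∀ s : Fin T, (s : ℕ) < t → σ s = σ' s) :
    packets p σ t = packets p' σ' t := by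
  induction t with
  | zero => rfl
  | succ t ih =>
    have ih' := ih (fun s hs => hp s (by omega)) (fun s hs => hσ s (by omega))
    by_cases h : t < T
    · simp only [packets, h, dite_true, ih', hp ⟨t, h⟩ (by simp), hσ ⟨t, h⟩ (by simp)]
    · simp only [packets, h, dite_false, ih']

theorem packets_flipAt {T : ℕ} (p : Schedule T) (σ : AdvSeq T) (t : ℕ) (s : Fin T)
    (h : t ≤ s) : packets p (flipAt s σ) t = packets p σ t :=
  packets_congr t (fun _ _ => rfl) fun r hr =>
    flipAt_of_ne (by intro e; subst e; omega) σ

theorem packets_snd_congr {T : ℕ} (p : Schedule T) (σ σ' : AdvSeq T) (t : ℕ) :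
    (packets p σ t).2 = (packets p σ' t).2 := by
  induction t with
  | zero => rfl
  | succ t ih =>
    by_cases h : t < T
    · simp only [packets, h, dite_true, ih]
    · simp only [packets, h, dite_false, ih]

theorem packets_lt {T : ℕ} (p : Schedule T) (σ : AdvSeq T) (t : ℕ) :
    (packets p σ t).1 < t ∧ (packets p σ t).2 < t := by
  induction t with
  | zero => simp [packets]
  | succ t ih =>
    obtain ⟨h1, h2⟩ := ih
    by_cases h : t < T
    · simp only [packets, h, dite_true]
      push_cast
      constructor <;> split_ifs <;> omega
    · simp only [packets, h, dite_false]
      push_cast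
      omega

theorem packets_idle {T : ℕ} {p : Schedule T} (σ : AdvSeq T) {t : ℕ} (h : t < T)
    (hp : p ⟨t, h⟩ = SourceAction.idle) :
    packets p σ (t + 1) =
      (if σ ⟨t, h⟩ = true then (packets p σ t).2 else (packets p σ t).1, (packets p σ t).2) := by
  simp [packets, h, hp]

theorem packets_user {T : ℕ} {p : Schedule T} (σ : AdvSeq T) {t : ℕ} (h : t < T)
    (hp : p ⟨t, h⟩ = SourceAction.user) :
    packets p σ (t + 1) = ((t : ℤ), (packets p σ t).2) := by
  simp [packets, h, hp]

theorem packets_cache {T : ℕ} {p : Schedule T} (σ : AdvSeq T) {t : ℕ} (h : t < T)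
    (hp : p ⟨t, h⟩ = SourceAction.cache) :
    packets p σ (t + 1) =
      (if σ ⟨t, h⟩ = true then (t : ℤ) else (packets p σ t).1, (t : ℤ)) := by
  simp [packets, h, hp]

/-! ### Expected ages of a fixed schedule -/

/-- Expected age of the user before slot `t`. -/
noncomputable def expAge {T : ℕ} (p : Schedule T) (t : ℕ) : ℝ :=
  fairExp fun σ => (t : ℝ) - ((packets p σ t).1 : ℝ)

/-- Age of the cached packet before slot `t`; it does not depend on the adversary. -/
noncomputable def cacheAge {T : ℕ} (p : Schedule T) (t : ℕ) : ℝ :=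
  (t : ℝ) - ((packets p (fun _ => false) t).2 : ℝ)

theorem expAge_zero {T : ℕ} (p : Schedule T) : expAge p 0 = 1 := by
  simp [expAge, packets, fairExp_const]

theorem cacheAge_zero {T : ℕ} (p : Schedule T) : cacheAge p 0 = 1 := by
  simp [cacheAge, packets]

theorem cacheAge_idle {T : ℕ} {p : Schedule T} {t : ℕ} (h : t < T)
    (hp : p ⟨t, h⟩ = SourceAction.idle) : cacheAge p (t + 1) = cacheAge p t + 1 := by
  simp only [cacheAge, packets_idle _ h hp]; push_cast; ring

theorem cacheAge_user {T : ℕ} {p : Schedule T} {t : ℕ} (h : t < T)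
    (hp : p ⟨t, h⟩ = SourceAction.user) : cacheAge p (t + 1) = cacheAge p t + 1 := by
  simp only [cacheAge, packets_user _ h hp]; push_cast; ring

theorem cacheAge_cache {T : ℕ} {p : Schedule T} {t : ℕ} (h : t < T)
    (hp : p ⟨t, h⟩ = SourceAction.cache) : cacheAge p (t + 1) = 1 := by
  simp only [cacheAge, packets_cache _ h hp]; push_cast; ring

theorem expAge_user {T : ℕ} {p : Schedule T} {t : ℕ} (h : t < T)
    (hp : p ⟨t, h⟩ = SourceAction.user) : expAge p (t + 1) = 1 := by
  simp only [expAge, packets_user _ h hp]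
  push_cast
  simp [fairExp_const]

theorem expAge_idle {T : ℕ} {p : Schedule T} {t : ℕ} (h : t < T)
    (hp : p ⟨t, h⟩ = SourceAction.idle) :
    expAge p (t + 1) = (expAge p t + cacheAge p t + 2) / 2 := by
  have e : expAge p (t + 1) = fairExp fun σ => if σ ⟨t, h⟩ = true then cacheAge p t + 1
      else ((t : ℝ) - ((packets p σ t).1 : ℝ)) + 1 := by
    unfold expAge
    congr 1
    ext σ
    rw [packets_idle _ h hp, packets_snd_congr p σ (fun _ => false)]
    split_ifs <;> simp only [cacheAge] <;> push_cast <;> ring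
  rw [e, fairExp_ite _ _ _ (fun _ => rfl)
    (fun σ => by rw [packets_flipAt p σ t ⟨t, h⟩ le_rfl]), fairExp_const, fairExp_add,
    fairExp_const]
  simp only [expAge]; ring

theorem expAge_cache {T : ℕ} {p : Schedule T} {t : ℕ} (h : t < T)
    (hp : p ⟨t, h⟩ = SourceAction.cache) :
    expAge p (t + 1) = (expAge p t + 2) / 2 := by
  have e : expAge p (t + 1) = fairExp fun σ => if σ ⟨t, h⟩ = true then (1 : ℝ)
      else ((t : ℝ) - ((packets p σ t).1 : ℝ)) + 1 := by
    unfold expAge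
    congr 1
    ext σ
    rw [packets_cache _ h hp]
    split_ifs <;> push_cast <;> ring
  rw [e, fairExp_ite _ _ _ (fun _ => rfl)
    (fun σ => by rw [packets_flipAt p σ t ⟨t, h⟩ le_rfl]), fairExp_const, fairExp_add,
    fairExp_const]
  simp only [expAge]; ring

theorem fairExp_avgAge {T : ℕ} (p : Schedule T) :
    fairExp (avgAge p) = 1 / (T : ℝ) * ∑ t ∈ Finset.range T, expAge p t := by
  unfold avgAge
  rw [fairExp_const_mul, fairExp_sum, ← Fin.sum_univ_eq_sum_range]
  simp [expAge, age]

/-! ### Yao's bound -/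

theorem one_le_age {T : ℕ} (p : Schedule T) (σ : AdvSeq T) (t : Fin T) :
    (1 : ℝ) ≤ (age p σ t : ℝ) := by
  have := (packets_lt p σ t).1
  have h : 1 ≤ age p σ t := by unfold age; omega
  exact_mod_cast h

theorem one_le_avgAge {T : ℕ} (hT : 0 < T) (p : Schedule T) (σ : AdvSeq T) :
    1 ≤ avgAge p σ := by
  have hT' : (0 : ℝ) < T := by exact_mod_cast hT
  have : (T : ℝ) ≤ ∑ t : Fin T, (age p σ t : ℝ) := by
    calc (T : ℝ) = ∑ _t : Fin T, (1 : ℝ) := by simp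
      _ ≤ _ := Finset.sum_le_sum fun t _ => one_le_age p σ t
  unfold avgAge
  rw [one_div, inv_mul_eq_div, le_div_iff₀ hT']
  linarith

theorem feasible_idle {T : ℕ} (T₁ T₂ : ℕ) :
    Feasible T₁ T₂ (fun _ : Fin T => SourceAction.idle) := by
  simp [Feasible]

instance feasibleSchedule_nonempty {T : ℕ} (T₁ T₂ : ℕ) :
    Nonempty {p : Schedule T // Feasible T₁ T₂ p} :=
  ⟨⟨_, feasible_idle T₁ T₂⟩⟩

theorem one_le_offlineAge {T : ℕ} (hT : 0 < T) (T₁ T₂ : ℕ) (σ : AdvSeq T) :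
    1 ≤ offlineAge T₁ T₂ σ :=
  le_ciInf fun p => one_le_avgAge hT p.1 σ

theorem one_le_fairExp_offlineAge {T : ℕ} (hT : 0 < T) (T₁ T₂ : ℕ) :
    1 ≤ fairExp (offlineAge (T := T) T₁ T₂) := by
  rw [← fairExp_const (T := T) 1]
  exact fairExp_mono fun σ => one_le_offlineAge hT T₁ T₂ σ

theorem offlineAge_le {T : ℕ} {T₁ T₂ : ℕ} {p : Schedule T} (hp : Feasible T₁ T₂ p)
    (σ : AdvSeq T) : offlineAge T₁ T₂ σ ≤ avgAge p σ :=
  ciInf_le (Set.finite_range fun p : {p : Schedule T // Feasible T₁ T₂ p} =>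
    avgAge p.1 σ).bddBelow ⟨p, hp⟩

theorem bestDetAge_le {T : ℕ} {T₁ T₂ : ℕ} {p : Schedule T} (hp : Feasible T₁ T₂ p) :
    bestDetAge T T₁ T₂ ≤ fairExp (avgAge p) :=
  ciInf_le (Set.finite_range fun p : {p : Schedule T // Feasible T₁ T₂ p} =>
    fairExp (avgAge p.1)).bddBelow ⟨p, hp⟩

theorem randAvgAge_eq {T : ℕ} (π : PMF (Schedule T)) (σ : AdvSeq T) :
    randAvgAge π σ = ∑ p, (π p).toReal * avgAge p σ := by
  simp only [randAvgAge, avgAge]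
  rw [Finset.sum_comm, Finset.mul_sum]
  refine Finset.sum_congr rfl fun p _ => ?_
  rw [← Finset.mul_sum]; ring

theorem sum_toReal_pmf {α : Type*} [Fintype α] (π : PMF α) : ∑ a, (π a).toReal = 1 := by
  have h := π.tsum_coe
  rw [tsum_fintype] at h
  rw [← ENNReal.toReal_sum fun a _ => π.apply_ne_top a, h]
  rfl

theorem bestDetAge_div_le_competitiveRatio {T : ℕ} (hT : 0 < T) (T₁ T₂ : ℕ)
    (π : PMF (Schedule T)) (hπ : ∀ p ∈ π.support, Feasible T₁ T₂ p) :
    bestDetAge T T₁ T₂ / fairExp (offlineAge (T := T) T₁ T₂) ≤ competitiveRatio T₁ T₂ π := by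
  have hpos : 0 < fairExp (offlineAge (T := T) T₁ T₂) :=
    lt_of_lt_of_le one_pos (one_le_fairExp_offlineAge hT T₁ T₂)
  rw [div_le_iff₀ hpos, ← fairExp_const_mul]
  have h1 : fairExp (randAvgAge π)
      ≤ fairExp fun σ : AdvSeq T => competitiveRatio T₁ T₂ π * offlineAge T₁ T₂ σ := by
    refine fairExp_mono fun σ => ?_
    rw [← div_le_iff₀ (lt_of_lt_of_le one_pos (one_le_offlineAge hT T₁ T₂ σ))]
    exact le_ciSup (f := fun σ => randAvgAge π σ / offlineAge T₁ T₂ σ)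
      (Set.finite_range _).bddAbove σ
  refine le_trans ?_ h1
  have h2 : fairExp (randAvgAge π) = ∑ p, (π p).toReal * fairExp (avgAge p) := by
    rw [show randAvgAge π = fun σ => ∑ p, (π p).toReal * avgAge p σ from
      funext fun σ => randAvgAge_eq π σ, fairExp_sum]
    simp only [fairExp_const_mul]
  rw [h2]
  calc bestDetAge T T₁ T₂ = ∑ p, (π p).toReal * bestDetAge T T₁ T₂ := by
        rw [← Finset.sum_mul, sum_toReal_pmf, one_mul]
    _ ≤ _ := by
        refine Finset.sum_le_sum fun p _ => ?_
        by_cases h : π p = 0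
        · simp [h]
        · exact mul_le_mul_of_nonneg_left (bestDetAge_le (hπ p ((π.mem_support_iff p).2 h)))
            ENNReal.toReal_nonneg

/-! ### The potential function -/

/-- Potential of a cache update at which the expected age of the user is `z` below its stationary
value, when every section costs `θ` and multiplies `z` by `q`. -/
noncomputable def psi (q θ z : ℝ) : ℝ :=
  if z < 0 then z + θ else ⨅ k : ℕ, (q ^ (k + 1) * z + (k + 1) * θ)

theorem psi_of_neg {q θ z : ℝ} (hz : z < 0) : psi q θ z = z + θ := by
  simp [psi, hz]

theorem psi_le {q θ z : ℝ} (hq : 0 ≤ q) (hθ : 0 ≤ θ) (hz : 0 ≤ z) (k : ℕ) :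
    psi q θ z ≤ q ^ (k + 1) * z + (k + 1) * θ := by
  simp only [psi, not_lt.2 hz, if_false]
  refine ciInf_le (f := fun k : ℕ => q ^ (k + 1) * z + (k + 1) * θ) ⟨0, ?_⟩ k
  rintro _ ⟨i, rfl⟩
  positivity

theorem le_psi {q θ z c : ℝ} (hz : 0 ≤ z) (h : ∀ k : ℕ, c ≤ q ^ (k + 1) * z + (k + 1) * θ) :
    c ≤ psi q θ z := by
  simp only [psi, not_lt.2 hz, if_false]
  exact le_ciInf h

theorem theta_le_psi {q θ z : ℝ} (hq : 0 ≤ q) (hθ : 0 ≤ θ) (hz : 0 ≤ z) : θ ≤ psi q θ z := by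
  refine le_psi hz fun k => ?_
  have h1 : 0 ≤ q ^ (k + 1) * z := by positivity
  have h2 : 0 ≤ (k : ℝ) * θ := by positivity
  linarith

theorem psi_le_of_nonneg {q θ z : ℝ} (hq : 0 ≤ q) (hθ : 0 ≤ θ) (hz : 0 ≤ z) :
    psi q θ z ≤ q * z + θ := by
  simpa using psi_le hq hθ hz 0

theorem mul_half_pow_le (n : ℕ) : ((n : ℝ) + 1) * (1 / 2) ^ n ≤ 1 := by
  have h : (n : ℝ) + 1 ≤ 2 ^ n := by exact_mod_cast Nat.lt_two_pow_self (n := n)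
  rw [one_div, inv_pow, ← div_eq_mul_inv, div_le_one (by positivity)]
  exact h

theorem mul_half_pow_le_half (n : ℕ) : (n : ℝ) * (1 / 2) ^ n ≤ 1 / 2 := by
  cases n with
  | zero => norm_num
  | succ n =>
    have := mul_half_pow_le n
    push_cast
    rw [pow_succ]
    linarith

theorem half_pow_le_half {n : ℕ} (hn : 1 ≤ n) : (1 / 2 : ℝ) ^ n ≤ 1 / 2 := by
  simpa using pow_le_pow_of_le_one (by norm_num : (0 : ℝ) ≤ 1 / 2) (by norm_num) hn

theorem psi_section {x : ℕ} {ys θ y : ℝ} (hx : 1 ≤ x)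
    (hys : ys = x + (1 / 2) ^ x * ys) (hθ : 0 ≤ θ) (hy : 0 ≤ y) {L : ℕ} (hL : 1 ≤ L) :
    psi ((1 / 2) ^ x) θ (ys - y) ≤ psi ((1 / 2) ^ x) θ (ys - (L + y * (1 / 2) ^ L)) + θ
      + ((L : ℝ) - x) * (L - x + 1) / 2 := by
  set q : ℝ := (1 / 2) ^ x with hq
  set g : ℝ := (1 / 2) ^ L with hg
  have hq0 : 0 < q := by positivity
  have hg0 : 0 < g := by positivity
  have hqh : q ≤ 1 / 2 := half_pow_le_half hx
  have hgh : g ≤ 1 / 2 := half_pow_le_half hL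
  set z := ys - y with hz
  set z' := ys - (L + y * g) with hz'
  have he : 0 ≤ ((L : ℝ) - x) * (L - x + 1) / 2 := by
    rcases le_or_gt x L with h | h
    · have : (x : ℝ) ≤ L := by exact_mod_cast h
      have := mul_nonneg (sub_nonneg.2 this) (by linarith : (0 : ℝ) ≤ L - x + 1)
      linarith
    · have : (L : ℝ) + 1 ≤ x := by exact_mod_cast h
      have := mul_nonneg (by linarith : (0 : ℝ) ≤ x - L) (by linarith : (0 : ℝ) ≤ x - L - 1)
      linarith
  have key : z' = x - L + q * z + y * (q - g) := by rw [hz', hz]; linarith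
  rcases le_or_gt x L with hxL | hxL
  · have hxL' : (x : ℝ) ≤ L := by exact_mod_cast hxL
    have hgq : g ≤ q := pow_le_pow_of_le_one (by norm_num) (by norm_num) hxL
    have hlow : (x : ℝ) - L + q * z ≤ z' := by
      have := mul_nonneg hy (sub_nonneg.2 hgq); linarith
    have hLe : (L : ℝ) - x ≤ ((L : ℝ) - x) * (L - x + 1) / 2 := by
      rcases Nat.eq_or_lt_of_le hxL with h | h
      · subst h; simp
      · have : (x : ℝ) + 1 ≤ L := by exact_mod_cast h
        nlinarith
    rcases lt_or_ge z 0 with hz0 | hz0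
    · rw [psi_of_neg hz0]
      rcases lt_or_ge z' 0 with hz1 | hz1
      · rw [psi_of_neg hz1]
        have : z ≤ q * z := by nlinarith
        linarith
      · have := theta_le_psi hq0.le hθ hz1
        linarith
    · rcases lt_or_ge z' 0 with hz1 | hz1
      · rw [psi_of_neg hz1]
        have h1 := psi_le hq0.le hθ hz0 1
        norm_num at h1
        have : q ^ 2 * z ≤ q * z := by
          have := mul_nonneg hq0.le hz0
          nlinarith
        linarith
      · have : psi q θ z - θ - ((L : ℝ) - x) * (L - x + 1) / 2 ≤ psi q θ z' := by
          refine le_psi hz1 fun k => ?_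
          have h1 := psi_le hq0.le hθ hz0 (k + 1)
          have hk : q ^ (k + 1) ≤ 1 := pow_le_one₀ hq0.le (by linarith)
          have hk0 : 0 < q ^ (k + 1) := by positivity
          have h2 : q ^ (k + 1) * (x - L + q * z) ≤ q ^ (k + 1) * z' :=
            mul_le_mul_of_nonneg_left hlow hk0.le
          have h3 : q ^ (k + 1) * ((L : ℝ) - x) ≤ L - x := by nlinarith
          have h4 : q ^ (k + 1 + 1) * z = q ^ (k + 1) * (q * z) := by ring
          push_cast at h1
          linarith
        linarith
  · have hxL' : (L : ℝ) + 1 ≤ x := by exact_mod_cast hxL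
    have hqg : q ≤ g := pow_le_pow_of_le_one (by norm_num) (by norm_num) hxL.le
    rcases le_or_gt z z' with hzz | hzz
    · rcases lt_or_ge z 0 with hz0 | hz0
      · rw [psi_of_neg hz0]
        rcases lt_or_ge z' 0 with hz1 | hz1
        · rw [psi_of_neg hz1]; linarith
        · have := theta_le_psi hq0.le hθ hz1
          linarith
      · have hz1 : 0 ≤ z' := hz0.trans hzz
        have : psi q θ z ≤ psi q θ z' := by
          refine le_psi hz1 fun k => (psi_le hq0.le hθ hz0 k).trans ?_
          gcongr
        linarith
    · -- the age grows in this section, so that it is still small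
      have hyL : y * (1 - g) < L := by
        have : y < L + y * g := by linarith
        linarith
      have hLg : ((L : ℝ) + 1) * g ≤ 1 := mul_half_pow_le L
      have hyg : y * g ≤ 1 := by
        have : L * g ≤ 1 - g := by linarith
        have h1g : 0 < 1 - g := by linarith
        have : y * g * (1 - g) ≤ 1 * (1 - g) := by nlinarith
        exact le_of_mul_le_mul_right this h1g
      have hlow : q * z ≤ z' := by
        have : y * (g - q) ≤ 1 := by nlinarith [mul_nonneg hy hq0.le]
        linarith
      have hz1 : 0 ≤ z' := by
        by_contra hcon
        have : z * (1 - q) < 0 ∨ 0 ≤ z := by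
          rcases lt_or_ge z 0 with h | h
          · left; nlinarith
          · right; exact h
        rcases this with h | h
        · -- then `y` exceeds the stationary value, hence also `L / (1 - g)`
          have hz0 : z < 0 := by
            by_contra h0
            have := mul_nonneg (not_lt.1 h0) (by linarith : (0 : ℝ) ≤ 1 - q)
            linarith
          have : z' ≤ 0 := (not_le.1 hcon).le
          nlinarith
        · have := mul_nonneg hq0.le h
          linarith
      have hz0 : 0 ≤ z := hz1.trans hzz.le
      have : psi q θ z - θ ≤ psi q θ z' := by
        refine le_psi hz1 fun k => ?_
        have h1 := psi_le hq0.le hθ hz0 (k + 1)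
        have hk0 : 0 < q ^ (k + 1) := by positivity
        have h2 : q ^ (k + 1) * (q * z) ≤ q ^ (k + 1) * z' :=
          mul_le_mul_of_nonneg_left hlow hk0.le
        have h4 : q ^ (k + 1 + 1) * z = q ^ (k + 1) * (q * z) := by ring
        push_cast at h1
        linarith
      linarith

/-- The gain of an early direct update, over the section of length `x`. -/
theorem early_gain_le {x : ℕ} {ys : ℝ} (hys : ys = x + (1 / 2) ^ x * ys) {j : ℕ}
    (hj : 1 ≤ j) (hjx : j < x) :
    ys * ((1 / 2) ^ j - (1 / 2) ^ x) ≤ ((x : ℝ) - j + 1) / 2 := by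
  set q : ℝ := (1 / 2) ^ x with hq
  set g : ℝ := (1 / 2) ^ j with hg
  have hq0 : 0 < q := by positivity
  have hqh : q ≤ 1 / 2 := half_pow_le_half (by omega)
  have hgh : g ≤ 1 / 2 := half_pow_le_half hj
  have hg0 : 0 < g := by positivity
  have hjg := mul_half_pow_le_half j
  have hjx' : (j : ℝ) + 1 ≤ x := by exact_mod_cast hjx
  have h1 : ys * (1 - q) = x := by linarith
  have hys0 : 0 ≤ ys := by
    by_contra h
    have : ys * (1 - q) < 0 := mul_neg_of_neg_of_pos (not_le.1 h) (by linarith)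
    linarith [(Nat.cast_nonneg j : (0 : ℝ) ≤ j)]
  have h2 : ys * (g - q) ≤ ys * ((1 - q) * g) := by
    refine mul_le_mul_of_nonneg_left ?_ hys0
    nlinarith
  have h3 : ys * ((1 - q) * g) = x * g := by rw [← mul_assoc, h1]
  have h4 : ((x : ℝ) - j) * g ≤ (x - j) * (1 / 2) :=
    mul_le_mul_of_nonneg_left hgh (by linarith)
  linarith

theorem psi_userGain {x : ℕ} {ys θ y : ℝ} (hθ : 0 ≤ θ) (hy : 0 ≤ y) {j : ℕ} :
    y * (1 / 2) ^ j + psi ((1 / 2) ^ x) θ (ys - y)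
      ≤ (1 / 2) ^ x * ys + θ + max 0 (ys * ((1 / 2) ^ j - (1 / 2) ^ x)) := by
  set q : ℝ := (1 / 2) ^ x with hq
  set g : ℝ := (1 / 2) ^ j with hg
  have hq0 : 0 < q := by positivity
  have hg1 : g ≤ 1 := pow_le_one₀ (by norm_num) (by norm_num)
  have hm0 := le_max_left 0 (ys * (g - q))
  have hm1 := le_max_right 0 (ys * (g - q))
  rcases lt_or_ge (ys - y) 0 with h | h
  · rw [psi_of_neg h]
    nlinarith
  · have := psi_le_of_nonneg hq0.le hθ h
    rcases le_or_gt g q with hgq | hgq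
    · nlinarith
    · nlinarith

theorem psi_userSection {x : ℕ} {ys θ y : ℝ} (hx : 1 ≤ x)
    (hys : ys = x + (1 / 2) ^ x * ys) (hθ : 0 ≤ θ) (hy : 0 ≤ y) {j : ℕ} (hj : 1 ≤ j) (s : ℕ) :
    y * (1 / 2) ^ j + psi ((1 / 2) ^ x) θ (ys - 1) + psi ((1 / 2) ^ x) θ (ys - y)
      ≤ (1 / 2) ^ x * ys + psi ((1 / 2) ^ x) θ (ys - ((j : ℝ) + s + 1 - j * (1 / 2) ^ s)) + θ
        + ((j : ℝ) + s - x) * (j + s - x - 1) / 2 + 2 * s := by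
  have hgain := psi_userGain (x := x) (ys := ys) hθ hy (j := j)
  have hearly := early_gain_le hys hj
  have hqx : (x : ℝ) * (1 / 2) ^ x ≤ 1 / 2 := mul_half_pow_le_half x
  have hx' : (1 : ℝ) ≤ x := by exact_mod_cast hx
  have hjr : (1 : ℝ) ≤ j := by exact_mod_cast hj
  set q : ℝ := (1 / 2) ^ x with hq
  set g : ℝ := (1 / 2) ^ j with hg
  set w : ℝ := (1 / 2) ^ s with hw
  have hq0 : 0 < q := by positivity
  have hw0 : 0 < w := by positivity
  have hw1 : w ≤ 1 := pow_le_one₀ (by norm_num) (by norm_num)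
  have hqh : q ≤ 1 / 2 := half_pow_le_half hx
  have hjw : 0 ≤ j * w := by positivity
  have hjw1 : j * w ≤ j := by nlinarith
  have h1q : ys * (1 - q) = x := by linarith
  have hys1 : (1 : ℝ) ≤ ys := by nlinarith
  have hz1 : 0 ≤ ys - 1 := by linarith
  have hmax : max 0 (ys * (g - q)) = 0 ∧ x ≤ j ∨
      max 0 (ys * (g - q)) ≤ ((x : ℝ) - j + 1) / 2 ∧ j < x := by
    rcases le_or_gt x j with h | h
    · left
      have hgq : g ≤ q := pow_le_pow_of_le_one (by norm_num) (by norm_num) h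
      exact ⟨max_eq_left (by nlinarith), h⟩
    · right
      have : (j : ℝ) + 1 ≤ x := by exact_mod_cast h
      exact ⟨max_le (by linarith) (hearly h), h⟩
  rcases Nat.eq_zero_or_pos s with hs | hs
  · subst hs
    have e : ys - ((j : ℝ) + ((0 : ℕ) : ℝ) + 1 - j * w) = ys - 1 := by rw [hw]; simp
    rw [e]
    push_cast
    rcases hmax with ⟨hm, h⟩ | ⟨hm, h⟩
    · rw [hm] at hgain
      obtain ⟨d, rfl⟩ := Nat.exists_eq_add_of_le h
      have : (0 : ℝ) ≤ (d : ℝ) * (d - 1) := by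
        rcases d with _ | d
        · simp
        · push_cast; ring_nf; positivity
      have e2 : ((x + d : ℕ) + 0 - x : ℝ) * ((x + d : ℕ) + 0 - x - 1) / 2 = d * (d - 1) / 2 := by
        push_cast; ring
      linarith
    · have h' : (j : ℝ) + 1 ≤ x := by exact_mod_cast h
      nlinarith
  have hs' : (1 : ℝ) ≤ s := by exact_mod_cast hs
  set z' := ys - ((j : ℝ) + s + 1 - j * w) with hz'
  rcases lt_or_ge z' 0 with hz0 | hz0
  · have h1 := psi_le_of_nonneg hq0.le hθ hz1
    rw [psi_of_neg hz0]
    rcases hmax with ⟨hm, h⟩ | ⟨hm, h⟩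
    · rw [hm] at hgain
      obtain ⟨d, rfl⟩ := Nat.exists_eq_add_of_le h
      push_cast at *
      have hi : (0 : ℝ) ≤ ((d : ℝ) + s - 1) * (d + s - 2) := by
        obtain ⟨u, rfl⟩ := Nat.exists_eq_add_of_le hs
        rcases Nat.eq_zero_or_pos (d + u) with h0 | h0
        · have : d = 0 := by omega
          have : u = 0 := by omega
          subst_vars; simp
        · have : (1 : ℝ) ≤ d + u := by exact_mod_cast h0
          push_cast
          refine mul_nonneg ?_ ?_ <;> linarith
      have hd : (0 : ℝ) ≤ d := by positivity
      nlinarith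
    · obtain ⟨r, rfl⟩ := Nat.exists_eq_add_of_lt h
      push_cast at *
      have hi : (0 : ℝ) ≤ ((r : ℝ) + 1 - s) * (r + 1 - s + 2) + 3 * s - 3 := by
        rcases le_or_gt s (r + 1) with h0 | h0
        · have : (s : ℝ) ≤ r + 1 := by exact_mod_cast h0
          nlinarith
        · have : (r : ℝ) + 2 ≤ s := by exact_mod_cast h0
          have hr : (0 : ℝ) ≤ r := by positivity
          nlinarith [sq_nonneg ((r : ℝ) + 2 - s)]
      nlinarith
  · have hle : psi q θ (ys - 1) - q * (s + j) ≤ psi q θ z' := by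
      refine le_psi hz0 fun k => ?_
      have h1 := psi_le hq0.le hθ hz1 k
      have hkq : q ^ (k + 1) ≤ q := by
        rw [pow_succ]
        have : q ^ k ≤ 1 := pow_le_one₀ hq0.le (by linarith)
        nlinarith
      have h2 : q ^ (k + 1) * (ys - 1 - z') ≤ q * (ys - 1 - z') :=
        mul_le_mul_of_nonneg_right hkq (by rw [hz']; linarith)
      have h3 : q * (ys - 1 - z') ≤ q * (s + j) :=
        mul_le_mul_of_nonneg_left (by rw [hz']; linarith) hq0.le
      linarith
    rcases hmax with ⟨hm, h⟩ | ⟨hm, h⟩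
    · rw [hm] at hgain
      obtain ⟨d, rfl⟩ := Nat.exists_eq_add_of_le h
      push_cast at *
      have hd : (0 : ℝ) ≤ d := by positivity
      have h1 : q * (s + d) ≤ 1 / 2 * (s + d) :=
        mul_le_mul_of_nonneg_right hqh (by linarith)
      have e2 : ((x : ℝ) + d + s - x) * (x + d + s - x - 1) / 2
          = (d + s - 1) ^ 2 / 2 + (d + s - 1) / 2 := by ring
      have h2 := sq_nonneg ((d : ℝ) + s - 1)
      linarith
    · obtain ⟨r, rfl⟩ := Nat.exists_eq_add_of_lt h
      push_cast at *
      have hr : (0 : ℝ) ≤ r := by positivity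
      have h1 : q * s ≤ 1 / 2 * s := mul_le_mul_of_nonneg_right hqh (by linarith)
      have h2 := mul_nonneg hq0.le hr
      have e2 : ((j : ℝ) + s - (j + r + 1)) * (j + s - (j + r + 1) - 1) / 2
          = (r + 1 - s) ^ 2 / 2 + (r + 1 - s) / 2 := by ring
      have h3 := sq_nonneg ((r : ℝ) + 1 - s)
      linarith

/-! ### A lower bound for every feasible schedule -/

/-- Number of slots before `t` in which the source takes the action `a`. -/
def countBefore {T : ℕ} (p : Schedule T) (a : SourceAction) (t : ℕ) : ℕ :=
  (Finset.univ.filter fun s : Fin T => p s = a ∧ (s : ℕ) < t).card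

theorem countBefore_zero {T : ℕ} (p : Schedule T) (a : SourceAction) :
    countBefore p a 0 = 0 := by
  simp [countBefore]

theorem countBefore_succ {T : ℕ} (p : Schedule T) (a : SourceAction) {t : ℕ} (h : t < T) :
    countBefore p a (t + 1) = countBefore p a t + if p ⟨t, h⟩ = a then 1 else 0 := by
  unfold countBefore
  have hs : (Finset.univ.filter fun s : Fin T => p s = a ∧ (s : ℕ) < t + 1)
      = (Finset.univ.filter fun s : Fin T => p s = a ∧ (s : ℕ) < t) ∪
        (if p ⟨t, h⟩ = a then {⟨t, h⟩} else ∅) := by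
    ext s
    split_ifs with hp <;> simp only [Finset.mem_filter, Finset.mem_univ, true_and,
      Finset.mem_union, Finset.mem_singleton, Finset.notMem_empty, or_false, Fin.ext_iff]
    · constructor
      · rintro ⟨h1, h2⟩
        rcases Nat.lt_succ_iff_lt_or_eq.1 h2 with h3 | h3
        · exact Or.inl ⟨h1, h3⟩
        · exact Or.inr h3
      · rintro (⟨h1, h2⟩ | h1)
        · exact ⟨h1, by omega⟩
        · have : s = ⟨t, h⟩ := Fin.ext h1
          exact ⟨this ▸ hp, by omega⟩
    · refine and_congr_right fun h1 => ⟨fun h2 => ?_, fun h2 => by omega⟩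
      rcases Nat.lt_succ_iff_lt_or_eq.1 h2 with h3 | h3
      · exact h3
      · exact absurd ((show s = ⟨t, h⟩ from Fin.ext h3) ▸ h1) hp
  rw [hs, Finset.card_union_of_disjoint]
  · split_ifs <;> simp
  · split_ifs <;> simp

theorem countBefore_horizon {T : ℕ} (p : Schedule T) (a : SourceAction) :
    countBefore p a T = (Finset.univ.filter fun s : Fin T => p s = a).card := by
  simp [countBefore]

/-- The accumulated expected age, corrected by twice the current one: it grows by deterministic
amounts, except for direct updates. -/
noncomputable def corrSum {T : ℕ} (p : Schedule T) (t : ℕ) : ℝ :=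
  ∑ s ∈ Finset.range t, expAge p s + 2 * expAge p t

theorem corrSum_zero {T : ℕ} (p : Schedule T) : corrSum p 0 = 2 := by
  simp [corrSum, expAge_zero]

theorem corrSum_idle {T : ℕ} {p : Schedule T} {t : ℕ} (h : t < T)
    (hp : p ⟨t, h⟩ = SourceAction.idle) :
    corrSum p (t + 1) = corrSum p t + cacheAge p t + 2 := by
  rw [corrSum, corrSum, Finset.sum_range_succ, expAge_idle h hp]; ring

theorem corrSum_cache {T : ℕ} {p : Schedule T} {t : ℕ} (h : t < T)
    (hp : p ⟨t, h⟩ = SourceAction.cache) : corrSum p (t + 1) = corrSum p t + 2 := by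
  rw [corrSum, corrSum, Finset.sum_range_succ, expAge_cache h hp]; ring

theorem corrSum_user {T : ℕ} {p : Schedule T} {t : ℕ} (h : t < T)
    (hp : p ⟨t, h⟩ = SourceAction.user) :
    corrSum p (t + 1) = corrSum p t + 2 - expAge p t := by
  rw [corrSum, corrSum, Finset.sum_range_succ, expAge_user h hp]; ring

/-- The bound on the accumulated age inside a section, before or after its direct update. Here `y`
is the expected age at the last cache update, `μ` and `ν` are the prices of cache and user
updates. -/
theorem corrSum_lower_bound {T T₁ T₂ : ℕ} {p : Schedule T} (hp : Feasible T₁ T₂ p) {x : ℕ}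
    {ys θ μ ν : ℝ} (hx : 1 ≤ x) (hys : ys = x + (1 / 2) ^ x * ys) (hθ : 0 ≤ θ)
    (hμ : μ = (x : ℝ) * (x - 1) / 2 + θ)
    (hν : ν = 2 * x - 1 + (1 / 2) ^ x * ys - psi ((1 / 2) ^ x) θ (ys - 1)) :
    ∀ t ≤ T,
      (∃ y : ℝ, 0 ≤ y ∧ ∃ β : ℕ, 1 ≤ β ∧ cacheAge p t = β ∧ expAge p t = β + y * (1 / 2) ^ β ∧
        psi ((1 / 2) ^ x) θ ys + (x + 1) * (t + 1 - β) - μ * countBefore p .cache t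
          - ν * countBefore p .user t - psi ((1 / 2) ^ x) θ (ys - y) + β * (β + 3) / 2
          ≤ corrSum p t) ∨
      (∃ y : ℝ, 0 ≤ y ∧ ∃ j : ℕ, 1 ≤ j ∧ ∃ s : ℕ, cacheAge p t = j + s + 1 ∧
        expAge p t = j + s + 1 - j * (1 / 2) ^ s ∧
        (∃ r : Fin T, (r : ℕ) < t ∧ p r = .user ∧
          ∀ r' : Fin T, r < r' → (r' : ℕ) < t → p r' ≠ .cache) ∧
        psi ((1 / 2) ^ x) θ ys + (x + 1) * (t - (j + s)) - μ * countBefore p .cache t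
          - ν * (countBefore p .user t - 1) - psi ((1 / 2) ^ x) θ (ys - y)
          + (j + s + 1) * (j + s + 4) / 2 - 2 * j - y * (1 / 2) ^ j ≤ corrSum p t) := by
  intro t
  induction t with
  | zero =>
    intro _
    refine Or.inl ⟨0, le_rfl, 1, le_rfl, ?_, ?_, ?_⟩
    · simp [cacheAge_zero]
    · simp [expAge_zero]
    · simp only [countBefore_zero, corrSum_zero, sub_zero]; norm_num
  | succ t ih =>
    intro ht
    have h : t < T := ht
    have hc := countBefore_succ p .cache h
    have hu := countBefore_succ p .user h
    rcases ih h.le with ⟨y, hy, β, hβ, hb, ha, hQ⟩ | ⟨y, hy, j, hj, s, hb, ha, ⟨r, hr, hru, hrc⟩, hQ⟩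
    · rcases hact : p ⟨t, h⟩ with _ | _ | _
      · refine Or.inl ⟨y, hy, β + 1, by omega, ?_, ?_, ?_⟩
        · rw [cacheAge_idle h hact, hb]; push_cast; ring
        · rw [expAge_idle h hact, hb, ha, pow_succ]; push_cast; ring
        · rw [corrSum_idle h hact, hb, hc, hu]
          simp only [hact, reduceCtorEq, if_false, add_zero]
          push_cast
          linarith
      · refine Or.inr ⟨y, hy, β, hβ, 0, ?_, ?_, ⟨⟨t, h⟩, by simp, hact, ?_⟩, ?_⟩
        · rw [cacheAge_user h hact, hb]; push_cast; ring
        · rw [expAge_user h hact]; push_cast; ring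
        · intro r' h1 h2
          have : t < (r' : ℕ) := h1
          omega
        · rw [corrSum_user h hact, ha, hc, hu]
          simp only [hact, reduceCtorEq, if_false, if_true, add_zero]
          push_cast
          linarith
      · have hβ0 : (0 : ℝ) ≤ y * (1 / 2) ^ β := by positivity
        refine Or.inl ⟨β + y * (1 / 2) ^ β, by positivity, 1, le_rfl, ?_, ?_, ?_⟩
        · rw [cacheAge_cache h hact]; norm_num
        · rw [expAge_cache h hact, ha]; push_cast; ring
        · rw [corrSum_cache h hact, hc, hu]
          simp only [hact, reduceCtorEq, if_false, if_true, add_zero]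
          have hstep := psi_section hx hys hθ hy hβ
          push_cast
          rw [hμ] at hQ ⊢
          linarith
    · rcases hact : p ⟨t, h⟩ with _ | _ | _
      · refine Or.inr ⟨y, hy, j, hj, s + 1, ?_, ?_, ⟨r, by omega, hru, ?_⟩, ?_⟩
        · rw [cacheAge_idle h hact, hb]; push_cast; ring
        · rw [expAge_idle h hact, hb, ha, pow_succ]; push_cast; ring
        · intro r' h1 h2
          rcases Nat.lt_succ_iff_lt_or_eq.1 h2 with h3 | h3
          · exact hrc r' h1 h3
          · rw [show r' = ⟨t, h⟩ from Fin.ext h3, hact]; simp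
        · rw [corrSum_idle h hact, hb, hc, hu]
          simp only [hact, reduceCtorEq, if_false, add_zero]
          push_cast
          linarith
      · obtain ⟨r', h1, h2, h3⟩ := hp.2.2 r ⟨t, h⟩ hr hru hact
        exact absurd h3 (hrc r' h1 h2)
      · have hpow : (1 / 2 : ℝ) ^ s ≤ 1 := pow_le_one₀ (by norm_num) (by norm_num)
        have hjr : (0 : ℝ) ≤ j := by positivity
        have hsr : (0 : ℝ) ≤ s := by positivity
        refine Or.inl ⟨j + s + 1 - j * (1 / 2) ^ s, by nlinarith, 1, le_rfl, ?_, ?_, ?_⟩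
        · rw [cacheAge_cache h hact]; norm_num
        · rw [expAge_cache h hact, ha]; push_cast; ring
        · rw [corrSum_cache h hact, hc, hu]
          simp only [hact, reduceCtorEq, if_false, if_true, add_zero]
          have hstep := psi_userSection hx hys hθ hy hj s
          push_cast
          rw [hμ] at hQ ⊢
          rw [hν] at hQ ⊢
          linarith

theorem psi_add_self_le {q θ ys y : ℝ} (hq : 0 ≤ q) (hq1 : q ≤ 1) (hθ : 0 ≤ θ) (hys : 0 ≤ ys) :
    psi q θ (ys - y) + y ≤ 2 * ys + θ := by
  rcases lt_or_ge (ys - y) 0 with h | h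
  · rw [psi_of_neg h]; linarith
  · have := psi_le_of_nonneg hq hθ h
    have : q * (ys - y) ≤ 1 * (ys - y) := mul_le_mul_of_nonneg_right hq1 h
    linarith

/-- Every feasible schedule pays `x + 1` per slot, up to the prices `μ` and `ν` of its updates. -/
theorem sum_expAge_lower_bound {x : ℕ} {ys θ μ ν : ℝ} (hx : 1 ≤ x)
    (hys : ys = x + (1 / 2) ^ x * ys) (hys0 : 0 ≤ ys) (hθ : 0 ≤ θ)
    (hμ : μ = (x : ℝ) * (x - 1) / 2 + θ)
    (hν : ν = 2 * x - 1 + (1 / 2) ^ x * ys - psi ((1 / 2) ^ x) θ (ys - 1)) (hν0 : 0 ≤ ν) :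
    ∃ K : ℝ, ∀ (T T₁ T₂ : ℕ) (p : Schedule T), Feasible T₁ T₂ p →
      (x + 1) * T - μ * T₂ - ν * T₁ - K ≤ ∑ t ∈ Finset.range T, expAge p t := by
  refine ⟨2 * ys + θ + (2 * x + 7) ^ 2 / 8, fun T T₁ T₂ p hp => ?_⟩
  have hx' : (1 : ℝ) ≤ x := by exact_mod_cast hx
  have hμ0 : 0 ≤ μ := by
    rw [hμ]
    have := mul_nonneg (by linarith : (0 : ℝ) ≤ x) (by linarith : (0 : ℝ) ≤ (x : ℝ) - 1)
    linarith
  have hq0 : (0 : ℝ) ≤ (1 / 2) ^ x := by positivity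
  have hq1 : (1 / 2 : ℝ) ^ x ≤ 1 := pow_le_one₀ (by norm_num) (by norm_num)
  have hC : μ * countBefore p .cache T ≤ μ * T₂ := by
    refine mul_le_mul_of_nonneg_left ?_ hμ0
    rw [countBefore_horizon]; exact_mod_cast hp.2.1
  have hU : ν * countBefore p .user T ≤ ν * T₁ := by
    refine mul_le_mul_of_nonneg_left ?_ hν0
    rw [countBefore_horizon]; exact_mod_cast hp.1
  have hpsi0 := theta_le_psi hq0 hθ hys0
  rcases corrSum_lower_bound hp hx hys hθ hμ hν T le_rfl with
    ⟨y, hy, β, hβ, -, ha, hQ⟩ | ⟨y, hy, j, hj, s, -, ha, -, hQ⟩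
  · rw [corrSum, ha] at hQ
    have h1 := psi_add_self_le (y := y) hq0 hq1 hθ hys0
    have h2 : y * (1 / 2) ^ β ≤ y * (1 / 2) :=
      mul_le_mul_of_nonneg_left (half_pow_le_half hβ) hy
    have h3 := sq_nonneg ((β : ℝ) - (2 * x + 7) / 2)
    have hβr : (0 : ℝ) ≤ β := by positivity
    nlinarith
  · rw [corrSum, ha] at hQ
    have h1 := psi_add_self_le (y := y) hq0 hq1 hθ hys0
    have h2 : y * (1 / 2) ^ j ≤ y * 1 :=
      mul_le_mul_of_nonneg_left (pow_le_one₀ (by norm_num) (by norm_num)) hy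
    have h3 := sq_nonneg ((j : ℝ) + s + 1 - (2 * x + 7) / 2)
    have hjr : (0 : ℝ) ≤ j := by positivity
    have hsr : (0 : ℝ) ≤ s := by positivity
    have h4 : 0 ≤ j * (1 / 2 : ℝ) ^ s := by positivity
    nlinarith

/-! ### The stationary age and the optimal constant -/

/-- Fixed point of the expected age at the cache updates of sections of length `x`. -/
noncomputable def statAge (x : ℕ) : ℝ := (x : ℝ) / (1 - (1 / 2) ^ x)

theorem statAge_eq {x : ℕ} (hx : 1 ≤ x) : statAge x = x + (1 / 2) ^ x * statAge x := by
  have h : (1 / 2 : ℝ) ^ x ≤ 1 / 2 := half_pow_le_half hx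
  have h' : (1 - (1 / 2 : ℝ) ^ x) ≠ 0 := by linarith
  have : statAge x * (1 - (1 / 2) ^ x) = x := by
    rw [statAge, div_mul_cancel₀ _ h']
  linarith

theorem one_le_statAge {x : ℕ} (hx : 1 ≤ x) : 1 ≤ statAge x := by
  have h : (1 / 2 : ℝ) ^ x ≤ 1 / 2 := half_pow_le_half hx
  have h0 : (0 : ℝ) < (1 / 2) ^ x := by positivity
  have hx' : (1 : ℝ) ≤ x := by exact_mod_cast hx
  rw [statAge, le_div_iff₀ (by linarith)]
  linarith

theorem onlineConst_eq {x : ℕ} (hx : 1 ≤ x) (x₃ : ℕ) :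
    onlineConst x x₃ = (x₃ : ℝ) * x * (x + 3) / 2 + 2 - statAge x
      + ((1 / 2) ^ x) ^ x₃ * (statAge x - 1) := by
  have h2 : (1 : ℝ) < 2 ^ x := one_lt_pow₀ (by norm_num) (by omega)
  have h2' : (2 : ℝ) ^ x - 1 ≠ 0 := by linarith
  have e1 : statAge x = x * 2 ^ x / (2 ^ x - 1) := by
    rw [statAge, one_div, inv_pow]
    field_simp
  have e2 : ((1 / 2 : ℝ) ^ x) ^ x₃ = 1 / 2 ^ (x * x₃) := by
    rw [← pow_mul, one_div, inv_pow, one_div]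
  rw [onlineConst, e2, e1]
  ring

theorem bernoulli_pow_le {q : ℝ} (hq0 : 0 < q) (k m : ℕ) :
    q ^ m + m * (q ^ m * (1 - q)) ≤ q ^ k + k * (q ^ m * (1 - q)) := by
  rcases le_total m k with h | h
  · obtain ⟨d, rfl⟩ := Nat.exists_eq_add_of_le h
    have := one_add_mul_le_pow (a := q - 1) (by linarith) d
    have e : 1 + (q - 1) = q := by ring
    rw [e] at this
    have hm : 0 ≤ q ^ m := by positivity
    rw [pow_add]
    push_cast
    nlinarith [mul_le_mul_of_nonneg_left this hm]
  · obtain ⟨d, rfl⟩ := Nat.exists_eq_add_of_le h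
    have h1 : q ^ d * (1 + d * (1 - q)) ≤ 1 := by
      clear h
      induction d with
      | zero => simp
      | succ d ih =>
        have h0 : 0 ≤ q ^ d := by positivity
        have hd : q * (1 + ((d + 1 : ℕ) : ℝ) * (1 - q)) ≤ 1 + d * (1 - q) := by
          push_cast
          have := mul_nonneg (Nat.cast_nonneg d : (0 : ℝ) ≤ d) (sq_nonneg (1 - q))
          nlinarith [sq_nonneg (1 - q)]
        calc q ^ (d + 1) * (1 + ((d + 1 : ℕ) : ℝ) * (1 - q))
            = q ^ d * (q * (1 + ((d + 1 : ℕ) : ℝ) * (1 - q))) := by ring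
          _ ≤ q ^ d * (1 + d * (1 - q)) := mul_le_mul_of_nonneg_left hd h0
          _ ≤ 1 := ih
    have hk : 0 ≤ q ^ k := by positivity
    rw [pow_add]
    push_cast
    nlinarith [mul_le_mul_of_nonneg_left h1 hk]

theorem sum_expAge_ge_onlineConst {x x₃ : ℕ} (hx : 1 ≤ x) (hx₃ : 1 ≤ x₃) :
    ∃ K : ℝ, ∀ (n : ℕ) (p : Schedule (horizon x x₃ n)), Feasible n (x₃ * n) p →
      n * onlineConst x x₃ - K ≤ ∑ t ∈ Finset.range (horizon x x₃ n), expAge p t := by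
  set q : ℝ := (1 / 2) ^ x with hq
  set ys := statAge x with hys_def
  have hys : ys = x + q * ys := statAge_eq hx
  have hys1 : 1 ≤ ys := one_le_statAge hx
  have hq0 : 0 < q := by positivity
  have hqh : q ≤ 1 / 2 := half_pow_le_half hx
  have hx' : (1 : ℝ) ≤ x := by exact_mod_cast hx
  set θ : ℝ := q ^ x₃ * (1 - q) * (ys - 1) with hθ_def
  have hθ : 0 ≤ θ := mul_nonneg (mul_nonneg (by positivity) (by linarith)) (by linarith)
  set ν : ℝ := 2 * x - 1 + q * ys - psi q θ (ys - 1) with hν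
  have hqx₃ : q ^ x₃ ≤ q := by
    simpa using pow_le_pow_of_le_one hq0.le (by linarith) hx₃
  have hθ_le : θ ≤ x / 2 := by
    have e : θ = q ^ x₃ * (x - 1 + q) := by
      rw [hθ_def, mul_assoc]; congr 1; linarith
    rw [e]
    have : q ^ x₃ * (x - 1 + q) ≤ 1 / 2 * (x - 1 + q) :=
      mul_le_mul_of_nonneg_right (by linarith) (by linarith)
    linarith
  have hν0 : 0 ≤ ν := by
    have := psi_le_of_nonneg hq0.le hθ (by linarith : 0 ≤ ys - 1)
    rw [hν]; linarith
  have hpsi : q ^ x₃ * (ys - 1) + x₃ * θ ≤ psi q θ (ys - 1) := by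
    refine le_psi (by linarith) fun k => ?_
    have := mul_le_mul_of_nonneg_right (bernoulli_pow_le hq0 (k + 1) x₃)
      (by linarith : 0 ≤ ys - 1)
    rw [hθ_def]
    push_cast at this
    linarith
  obtain ⟨K, hK⟩ := sum_expAge_lower_bound hx hys (by linarith) hθ rfl hν hν0
  refine ⟨K - (x + 1) * x, fun n p hp => le_trans ?_ (hK _ n (x₃ * n) p hp)⟩
  have hn : (n : ℝ) * (q ^ x₃ * (ys - 1) + x₃ * θ) ≤ n * psi q θ (ys - 1) :=
    mul_le_mul_of_nonneg_left hpsi (Nat.cast_nonneg n)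
  have e : (n : ℝ) * onlineConst x x₃ = n * ((x₃ : ℝ) * x * (x + 3) / 2 + 2 - ys
      + q ^ x₃ * (ys - 1)) := by rw [onlineConst_eq hx]
  have e' : (n : ℝ) * ys = n * x + n * (q * ys) := by rw [← mul_add, ← hys]
  rw [e, hν, horizon]
  push_cast
  linarith

/-! ### Sections -/

theorem sectionEnd_zero (x x₃ : ℕ) : sectionEnd x x₃ 0 = 0 := by simp [sectionEnd]

theorem sectionEnd_succ (x x₃ i : ℕ) :
    sectionEnd x x₃ (i + 1) = sectionEnd x x₃ i + x + if x₃ ∣ i + 1 then 1 else 0 := by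
  simp only [sectionEnd, Nat.succ_div]
  ring

theorem sectionEnd_add_le (x x₃ i : ℕ) : sectionEnd x x₃ i + x ≤ sectionEnd x x₃ (i + 1) := by
  rw [sectionEnd_succ]; omega

theorem sectionEnd_strictMono {x : ℕ} (hx : 1 ≤ x) (x₃ : ℕ) : StrictMono (sectionEnd x x₃) :=
  strictMono_nat_of_lt_succ fun i => by have := sectionEnd_add_le x x₃ i; omega

theorem sectionEnd_mul (x : ℕ) {x₃ : ℕ} (hx₃ : 1 ≤ x₃) (m : ℕ) :
    sectionEnd x x₃ (m * x₃) = m * x₃ * x + m := by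
  rw [sectionEnd, Nat.mul_div_cancel _ (by omega)]

theorem horizon_eq (x : ℕ) {x₃ : ℕ} (hx₃ : 1 ≤ x₃) (n : ℕ) :
    horizon x x₃ n = sectionEnd x x₃ (x₃ * n) + x := by
  rw [mul_comm x₃ n, sectionEnd_mul x hx₃, horizon]; ring

/-- The `x` slots from the end of section `i` on contain no direct update. -/
theorem not_isUserSlot {x x₃ n t i : ℕ} (hx : 1 ≤ x)
    (h1 : sectionEnd x x₃ i ≤ t + 1) (h2 : t + 1 < sectionEnd x x₃ i + x) :
    ¬ IsUserSlot x x₃ n t := by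
  rintro ⟨m, -, hm⟩
  have hmono := sectionEnd_strictMono hx x₃
  have hi : i < m * x₃ := hmono.lt_iff_lt.1 (by omega)
  have h3 := sectionEnd_succ x x₃ i
  have h4 : sectionEnd x x₃ (i + 1) ≤ sectionEnd x x₃ (m * x₃) := hmono.monotone hi
  have h5 : i + 1 = m * x₃ := hmono.injective (by split_ifs at h3 <;> omega)
  rw [if_pos (h5 ▸ Dvd.intro_left m rfl)] at h3
  omega

theorem isUserSlot_of_dvd {x x₃ n t i : ℕ} (hd : x₃ ∣ i + 1) (hi : i + 1 ≤ x₃ * n)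
    (ht : t + 2 = sectionEnd x x₃ (i + 1)) : IsUserSlot x x₃ n t := by
  obtain ⟨m, hm⟩ := hd
  have hpos : 0 < x₃ * m := by omega
  refine ⟨m, Finset.mem_Icc.2 ⟨Nat.pos_of_mul_pos_left hpos, ?_⟩, by rw [ht, hm, mul_comm]⟩
  rw [hm] at hi
  exact Nat.le_of_mul_le_mul_left hi (Nat.pos_of_mul_pos_right hpos)

theorem checkPolicy_idle {x x₃ n t i : ℕ} (hx : 1 ≤ x) (h : t < horizon x x₃ n)
    (h1 : sectionEnd x x₃ i ≤ t) (h2 : t + 1 < sectionEnd x x₃ i + x) :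
    checkPolicy x x₃ n ⟨t, h⟩ = SourceAction.idle := by
  have hc : ¬ IsCacheSlot x x₃ n t := by
    rintro ⟨k, -, hk⟩
    have hmono := sectionEnd_strictMono hx x₃
    have h3 : i < k := hmono.lt_iff_lt.1 (by omega)
    have h4 : sectionEnd x x₃ (i + 1) ≤ sectionEnd x x₃ k := hmono.monotone h3
    have := sectionEnd_add_le x x₃ i
    omega
  simp [checkPolicy, not_isUserSlot (n := n) hx (by omega) h2, hc]

theorem checkPolicy_cache {x x₃ n t i : ℕ} (hx : 1 ≤ x) (h : t < horizon x x₃ n)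
    (hi : i ∈ Finset.Icc 1 (x₃ * n)) (ht : t + 1 = sectionEnd x x₃ i) :
    checkPolicy x x₃ n ⟨t, h⟩ = SourceAction.cache := by
  have hc : IsCacheSlot x x₃ n t := ⟨i, hi, ht⟩
  simp [checkPolicy, not_isUserSlot (x₃ := x₃) (n := n) (t := t) (i := i) hx (by omega) (by omega), hc]

theorem checkPolicy_user {x x₃ n t i : ℕ} (h : t < horizon x x₃ n)
    (hd : x₃ ∣ i + 1) (hi : i + 1 ≤ x₃ * n) (ht : t + 2 = sectionEnd x x₃ (i + 1)) :
    checkPolicy x x₃ n ⟨t, h⟩ = SourceAction.user := by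
  simp [checkPolicy, isUserSlot_of_dvd hd hi ht]

/-! ### Feasibility -/

theorem card_userSlots_le (x x₃ n T : ℕ) :
    (Finset.univ.filter fun t : Fin T => IsUserSlot x x₃ n t).card ≤ n := by
  have hinj : Function.Injective fun t : Fin T => (t : ℕ) + 2 := fun a b h =>
    Fin.ext (by simpa using h)
  rw [← Finset.card_image_of_injective _ hinj]
  calc _ ≤ ((Finset.Icc 1 n).image fun m => sectionEnd x x₃ (m * x₃)).card := by
        refine Finset.card_le_card fun u hu => ?_
        obtain ⟨t, ht, rfl⟩ := Finset.mem_image.1 hu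
        obtain ⟨m, hm, h⟩ := (Finset.mem_filter.1 ht).2
        exact Finset.mem_image.2 ⟨m, hm, h.symm⟩
    _ ≤ (Finset.Icc 1 n).card := Finset.card_image_le
    _ = n := by simp

theorem card_cacheSlots_le (x x₃ n T : ℕ) :
    (Finset.univ.filter fun t : Fin T => IsCacheSlot x x₃ n t).card ≤ x₃ * n := by
  have hinj : Function.Injective fun t : Fin T => (t : ℕ) + 1 := fun a b h =>
    Fin.ext (by simpa using h)
  rw [← Finset.card_image_of_injective _ hinj]
  calc _ ≤ ((Finset.Icc 1 (x₃ * n)).image fun m => sectionEnd x x₃ m).card := by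
        refine Finset.card_le_card fun u hu => ?_
        obtain ⟨t, ht, rfl⟩ := Finset.mem_image.1 hu
        obtain ⟨m, hm, h⟩ := (Finset.mem_filter.1 ht).2
        exact Finset.mem_image.2 ⟨m, hm, h.symm⟩
    _ ≤ (Finset.Icc 1 (x₃ * n)).card := Finset.card_image_le
    _ = x₃ * n := by simp

theorem delayedCacheSlot_unique {x x₃ T i : ℕ} {σ : AdvSeq T} {s t : Fin T}
    (hs1 : sectionEnd x x₃ i ≤ (s : ℕ) + 1)
    (hs2 : σ s = true ∨ (s : ℕ) + 2 = sectionEnd x x₃ i + x)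
    (ht1 : (t : ℕ) + 1 < sectionEnd x x₃ i + x)
    (ht2 : ∀ r : Fin T, sectionEnd x x₃ i ≤ (r : ℕ) + 1 → r < t → σ r = false) : ¬ s < t := by
  intro hst
  rcases hs2 with h | h
  · rw [ht2 s hs1 hst] at h; simp at h
  · have : (s : ℕ) < t := hst
    omega

theorem card_delayedCacheSlots_le (x x₃ n T : ℕ) (σ : AdvSeq T) :
    (Finset.univ.filter fun t : Fin T => IsDelayedCacheSlot x x₃ n σ t).card ≤ x₃ * n := by
  classical
  choose! f hf using fun (t : Fin T) (h : IsDelayedCacheSlot x x₃ n σ t) => h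
  calc _ ≤ (Finset.Icc 1 (x₃ * n)).card := by
        refine Finset.card_le_card_of_injOn f (fun t ht => ?_) fun s hs t ht hst => ?_
        · exact (hf t (by simpa using ht)).1
        · obtain ⟨-, s1, s2, s3, s4⟩ := hf s (by simpa using hs)
          obtain ⟨-, t1, t2, t3, t4⟩ := hf t (by simpa using ht)
          rw [hst] at s1 s2 s3 s4
          exact le_antisymm (not_lt.1 (delayedCacheSlot_unique t1 t4 s2 s3))
            (not_lt.1 (delayedCacheSlot_unique s1 s4 t2 t3))
    _ = x₃ * n := by simp

/-- Between two direct updates there is a whole window of `x` slots. -/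
theorem exists_section_between {x x₃ n s t : ℕ} (hx : 1 ≤ x) (hx₃ : 1 ≤ x₃) (hst : s < t)
    (hs : IsUserSlot x x₃ n s) (ht : IsUserSlot x x₃ n t) :
    ∃ i ∈ Finset.Icc 1 (x₃ * n), s + 2 = sectionEnd x x₃ i ∧ sectionEnd x x₃ i + x ≤ t + 1 := by
  obtain ⟨m, hm, hm'⟩ := hs
  obtain ⟨k, hk, hk'⟩ := ht
  have hmono := sectionEnd_strictMono hx x₃
  have h1 : m * x₃ < k * x₃ := hmono.lt_iff_lt.1 (by omega)
  have h2 : m < k := Nat.lt_of_mul_lt_mul_right h1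
  rw [Finset.mem_Icc] at hm hk
  refine ⟨m * x₃, Finset.mem_Icc.2 ⟨Nat.mul_pos hm.1 hx₃, ?_⟩, hm', ?_⟩
  · rw [mul_comm x₃]; exact Nat.mul_le_mul_right _ hm.2
  · rw [sectionEnd_mul x hx₃] at hk' ⊢
    obtain ⟨d, rfl⟩ := Nat.exists_eq_add_of_lt h2
    have : x ≤ x₃ * x := Nat.le_mul_of_pos_left x hx₃
    have e : (m + d + 1) * x₃ * x = m * x₃ * x + d * x₃ * x + x₃ * x := by ring
    omega

theorem feasible_checkPolicy {x x₃ : ℕ} (hx : 1 ≤ x) (hx₃ : 1 ≤ x₃) (n : ℕ) :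
    Feasible n (x₃ * n) (checkPolicy x x₃ n) := by
  have huser : ∀ t, checkPolicy x x₃ n t = .user → IsUserSlot x x₃ n t := by
    intro t ht
    by_contra h
    simp only [checkPolicy, h, if_false] at ht
    split_ifs at ht
  have hcache : ∀ t, checkPolicy x x₃ n t = .cache → IsCacheSlot x x₃ n t := by
    intro t ht
    by_contra h
    simp only [checkPolicy, h, if_false] at ht
    split_ifs at ht
  refine ⟨(Finset.card_le_card ?_).trans (card_userSlots_le x x₃ n _),
    (Finset.card_le_card ?_).trans (card_cacheSlots_le x x₃ n _), ?_⟩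
  · exact Finset.monotone_filter_right _ fun t _ => huser t
  · exact Finset.monotone_filter_right _ fun t _ => hcache t
  · intro s t hst hs ht
    obtain ⟨i, hi, h1, h2⟩ := exists_section_between hx hx₃ hst (huser s hs) (huser t ht)
    have hlt : (s : ℕ) + 1 < horizon x x₃ n := by have := t.2; omega
    refine ⟨⟨s + 1, hlt⟩, ?_, ?_, checkPolicy_cache hx hlt hi (by omega)⟩
    · exact Fin.lt_def.2 (by simp)
    · exact Fin.lt_def.2 (by show (s : ℕ) + 1 < t; omega)

/-- Every window contains the delayed cache update. -/
theorem exists_delayedSlot {x x₃ T i : ℕ} (hx : 1 ≤ x) (σ : AdvSeq T)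
    (hi : 1 ≤ sectionEnd x x₃ i) (hT : sectionEnd x x₃ i + x ≤ T + 1) :
    ∃ t : Fin T, sectionEnd x x₃ i ≤ (t : ℕ) + 1 ∧ (t : ℕ) + 1 < sectionEnd x x₃ i + x ∧
      (∀ s : Fin T, sectionEnd x x₃ i ≤ (s : ℕ) + 1 → s < t → σ s = false) ∧
      (σ t = true ∨ (t : ℕ) + 2 = sectionEnd x x₃ i + x) := by
  classical
  have hex : ∃ k : ℕ, ∃ h : k < T, sectionEnd x x₃ i ≤ k + 1 ∧
      (σ ⟨k, h⟩ = true ∨ k + 2 = sectionEnd x x₃ i + x) :=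
    ⟨sectionEnd x x₃ i + x - 2, by omega, by omega, Or.inr (by omega)⟩
  obtain ⟨h, h1, h2⟩ := Nat.find_spec hex
  have hle : Nat.find hex ≤ sectionEnd x x₃ i + x - 2 :=
    Nat.find_min' hex ⟨by omega, by omega, Or.inr (by omega)⟩
  refine ⟨⟨Nat.find hex, h⟩, h1, by show Nat.find hex + 1 < _; omega, fun s hs hst => ?_, h2⟩
  have := Nat.find_min hex (m := s) hst
  by_contra hcon
  exact this ⟨s.2, hs, Or.inl (by simpa using hcon)⟩

theorem feasible_offlineCheckPolicy {x x₃ : ℕ} (hx : 1 ≤ x) (hx₃ : 1 ≤ x₃) (n : ℕ)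
    (σ : AdvSeq (horizon x x₃ n)) : Feasible n (x₃ * n) (offlineCheckPolicy x x₃ n σ) := by
  have huser : ∀ t, offlineCheckPolicy x x₃ n σ t = .user → IsUserSlot x x₃ n t := by
    intro t ht
    by_contra h
    simp only [offlineCheckPolicy, h, if_false] at ht
    split_ifs at ht
  have hcache : ∀ t, offlineCheckPolicy x x₃ n σ t = .cache →
      IsDelayedCacheSlot x x₃ n σ t := by
    intro t ht
    by_contra h
    simp only [offlineCheckPolicy, h, if_false] at ht
    split_ifs at ht
  refine ⟨(Finset.card_le_card ?_).trans (card_userSlots_le x x₃ n _),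
    (Finset.card_le_card ?_).trans (card_delayedCacheSlots_le x x₃ n _ σ), ?_⟩
  · exact Finset.monotone_filter_right _ fun t _ => huser t
  · exact Finset.monotone_filter_right _ fun t _ => hcache t
  · intro s t hst hs ht
    obtain ⟨i, hi, h1, h2⟩ := exists_section_between hx hx₃ hst (huser s hs) (huser t ht)
    obtain ⟨r, r1, r2, r3, r4⟩ := exists_delayedSlot hx σ (by omega : 1 ≤ sectionEnd x x₃ i)
      (by have := t.2; omega)
    refine ⟨r, Fin.lt_def.2 (by omega), Fin.lt_def.2 (by omega), ?_⟩
    have hd : IsDelayedCacheSlot x x₃ n σ r := ⟨i, hi, r1, r2, r3, r4⟩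
    simp [offlineCheckPolicy, not_isUserSlot (n := n) hx r1 r2, hd]

/-! ### The expected age of `checkPolicy` -/

theorem idle_run {T : ℕ} {p : Schedule T} {t : ℕ} {Y : ℝ} (hb : cacheAge p t = 1)
    (ha : expAge p t = 1 + Y / 2) (k : ℕ) (hk : t + k ≤ T)
    (hp : ∀ s (h : s < T), t ≤ s → s < t + k → p ⟨s, h⟩ = SourceAction.idle) :
    cacheAge p (t + k) = k + 1 ∧ expAge p (t + k) = k + 1 + Y * (1 / 2) ^ (k + 1) ∧
      corrSum p (t + k) = corrSum p t + ((k : ℝ) + 1) * (k + 4) / 2 - 2 := by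
  induction k with
  | zero => refine ⟨by simp [hb], by simp [ha]; ring, by simp; ring⟩
  | succ k ih =>
    obtain ⟨h1, h2, h3⟩ := ih (by omega) fun s h hs hs' => hp s h hs (by omega)
    have hact := hp (t + k) (by omega) (by omega) (by omega)
    rw [← add_assoc]
    refine ⟨?_, ?_, ?_⟩
    · rw [cacheAge_idle _ hact, h1]; push_cast; ring
    · rw [expAge_idle _ hact, h1, h2, pow_succ (1 / 2 : ℝ) (k + 1)]; push_cast; ring
    · rw [corrSum_idle _ hact, h1, h3]; push_cast; ring

/-- Expected age under `checkPolicy` at the cache update that ends section `i`. -/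
noncomputable def checkAge (x x₃ : ℕ) : ℕ → ℝ
  | 0 => 0
  | i + 1 => if x₃ ∣ i + 1 then 1 else x + (1 / 2) ^ x * checkAge x x₃ i

/-- Value of `corrSum` for `checkPolicy` after section `i`. -/
noncomputable def checkCost (x x₃ : ℕ) : ℕ → ℝ
  | 0 => 2
  | i + 1 => checkCost x x₃ i + x * (x + 3) / 2 +
      if x₃ ∣ i + 1 then 2 - (x + (1 / 2) ^ x * checkAge x x₃ i) else 0

theorem checkPolicy_section {x x₃ n : ℕ} (hx : 1 ≤ x) (hx₃ : 1 ≤ x₃) (i : ℕ)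
    (hi : i ≤ x₃ * n) :
    cacheAge (checkPolicy x x₃ n) (sectionEnd x x₃ i) = 1 ∧
    expAge (checkPolicy x x₃ n) (sectionEnd x x₃ i) = 1 + checkAge x x₃ i / 2 ∧
    corrSum (checkPolicy x x₃ n) (sectionEnd x x₃ i) = checkCost x x₃ i := by
  induction i with
  | zero =>
    simp [sectionEnd_zero, cacheAge_zero, expAge_zero, corrSum_zero, checkAge, checkCost]
  | succ i ih =>
    obtain ⟨h1, h2, h3⟩ := ih (by omega)
    have hle : sectionEnd x x₃ (i + 1) ≤ sectionEnd x x₃ (x₃ * n) :=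
      (sectionEnd_strictMono hx x₃).monotone hi
    have hT := horizon_eq x hx₃ n
    have hs := sectionEnd_succ x x₃ i
    have hge := sectionEnd_add_le x x₃ i
    obtain ⟨g1, g2, g3⟩ := idle_run h1 h2 (x - 1) (by omega)
      fun s h hs hs' => checkPolicy_idle hx h hs (by omega)
    have hx1 : ((x - 1 : ℕ) : ℝ) = x - 1 := by push_cast [hx]; ring
    rw [Nat.sub_add_cancel hx] at g2
    rw [hx1] at g1 g2 g3
    set t := sectionEnd x x₃ i + (x - 1) with ht
    by_cases hd : x₃ ∣ i + 1
    · rw [if_pos hd] at hs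
      have hu := checkPolicy_user (x := x) (n := n) (t := t) (by omega) hd hi (by omega)
      have hc := checkPolicy_cache (n := n) (t := t + 1) hx (by omega)
        (Finset.mem_Icc.2 ⟨by omega, hi⟩) (by omega : t + 1 + 1 = sectionEnd x x₃ (i + 1))
      have e : sectionEnd x x₃ (i + 1) = t + 1 + 1 := by omega
      rw [e]
      refine ⟨cacheAge_cache _ hc, ?_, ?_⟩
      · rw [expAge_cache _ hc, expAge_user _ hu]; simp only [checkAge, if_pos hd]; ring
      · rw [corrSum_cache _ hc, corrSum_user _ hu, g2, g3, h3]
        simp only [checkCost, if_pos hd]; ring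
    · rw [if_neg hd] at hs
      have hc := checkPolicy_cache (n := n) (t := t) hx (by omega)
        (Finset.mem_Icc.2 ⟨by omega, hi⟩) (by omega : t + 1 = sectionEnd x x₃ (i + 1))
      have e : sectionEnd x x₃ (i + 1) = t + 1 := by omega
      rw [e]
      refine ⟨cacheAge_cache _ hc, ?_, ?_⟩
      · rw [expAge_cache _ hc, g2]; simp only [checkAge, if_neg hd]; ring
      · rw [corrSum_cache _ hc, g3, h3]
        simp only [checkCost, if_neg hd]; ring

theorem not_dvd_mul_add {x₃ m r : ℕ} (h0 : 0 < r) (h1 : r < x₃) : ¬ x₃ ∣ m * x₃ + r := by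
  rw [Nat.dvd_add_right (Dvd.intro_left m rfl)]
  exact Nat.not_dvd_of_pos_of_lt h0 h1

theorem checkAge_block {x x₃ : ℕ} (hx : 1 ≤ x) (m r : ℕ) (hr : r < x₃) :
    checkAge x x₃ (m * x₃ + r)
      = statAge x - ((1 / 2) ^ x) ^ r * (statAge x - checkAge x x₃ (m * x₃)) ∧
    checkCost x x₃ (m * x₃ + r) = checkCost x x₃ (m * x₃) + r * (x * (x + 3) / 2) := by
  induction r with
  | zero => simp
  | succ r ih =>
    obtain ⟨h1, h2⟩ := ih (by omega)
    have hd : ¬ x₃ ∣ m * x₃ + r + 1 := not_dvd_mul_add (r := r + 1) (by omega) hr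
    rw [← add_assoc]
    constructor
    · have := statAge_eq hx
      rw [checkAge, if_neg hd, h1, pow_succ]
      linarith
    · rw [checkCost, if_neg hd, h2]; push_cast; ring

theorem checkCost_block {x x₃ : ℕ} (hx : 1 ≤ x) (hx₃ : 1 ≤ x₃) (m : ℕ) :
    checkAge x x₃ ((m + 1) * x₃) = 1 ∧
    checkCost x x₃ ((m + 1) * x₃) = checkCost x x₃ (m * x₃) + onlineConst x x₃
      + ((1 / 2) ^ x) ^ x₃ * (1 - checkAge x x₃ (m * x₃)) := by
  obtain ⟨r, rfl⟩ := Nat.exists_eq_add_of_le' hx₃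
  obtain ⟨h1, h2⟩ := checkAge_block hx m r (Nat.lt_succ_self r)
  have e : (m + 1) * (r + 1) = m * (r + 1) + r + 1 := by ring
  have hd : (r + 1) ∣ m * (r + 1) + r + 1 := e ▸ Dvd.intro_left (m + 1) rfl
  have := statAge_eq hx
  rw [e]
  constructor
  · rw [checkAge, if_pos hd]
  · rw [checkCost, if_pos hd, h1, h2, onlineConst_eq hx, pow_succ]
    push_cast
    linarith

theorem checkCost_le {x x₃ : ℕ} (hx : 1 ≤ x) (hx₃ : 1 ≤ x₃) (m : ℕ) :
    checkCost x x₃ (m * x₃) ≤ 2 + m * onlineConst x x₃ + ((1 / 2) ^ x) ^ x₃ := by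
  have hpos : (0 : ℝ) < ((1 / 2) ^ x) ^ x₃ := by positivity
  cases m with
  | zero => simp [checkCost]
  | succ m =>
    induction m with
    | zero =>
      rw [(checkCost_block hx hx₃ 0).2]
      simp [checkCost, checkAge]
    | succ m ih =>
      rw [(checkCost_block hx hx₃ (m + 1)).2, (checkCost_block hx hx₃ m).1]
      push_cast at ih ⊢
      linarith

theorem expAge_nonneg {T : ℕ} (p : Schedule T) (t : ℕ) : 0 ≤ expAge p t := by
  rw [← fairExp_const (T := T) 0]
  refine fairExp_mono fun σ => ?_
  have := (packets_lt p σ t).1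
  have h : ((packets p σ t).1 : ℝ) < t := by exact_mod_cast this
  linarith

theorem sum_expAge_checkPolicy_le {x x₃ : ℕ} (hx : 1 ≤ x) (hx₃ : 1 ≤ x₃) :
    ∃ K : ℝ, ∀ n : ℕ, ∑ t ∈ Finset.range (horizon x x₃ n), expAge (checkPolicy x x₃ n) t
      ≤ n * onlineConst x x₃ + K := by
  refine ⟨((1 / 2) ^ x) ^ x₃ + ((x : ℝ) + 1) * (x + 4) / 2, fun n => ?_⟩
  obtain ⟨h1, h2, h3⟩ := checkPolicy_section (n := n) hx hx₃ (x₃ * n) le_rfl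
  have hT := horizon_eq x hx₃ n
  set e := sectionEnd x x₃ (x₃ * n) with he
  have key : ∑ t ∈ Finset.range (e + x), expAge (checkPolicy x x₃ n) t
      ≤ corrSum (checkPolicy x x₃ n) (e + x) := by
    rw [corrSum]; linarith [expAge_nonneg (checkPolicy x x₃ n) (e + x)]
  have hrun : corrSum (checkPolicy x x₃ n) (e + (x - 1)) =
      corrSum (checkPolicy x x₃ n) e + (((x - 1 : ℕ) : ℝ) + 1) * ((x - 1 : ℕ) + 4) / 2 - 2 ∧
      cacheAge (checkPolicy x x₃ n) (e + (x - 1)) = ((x - 1 : ℕ) : ℝ) + 1 := by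
    obtain ⟨g1, -, g3⟩ := idle_run h1 h2 (x - 1) (by omega)
      fun s h hs hs' => checkPolicy_idle (i := x₃ * n) hx h hs (by omega)
    exact ⟨g3, g1⟩
  have hlast : e + (x - 1) < horizon x x₃ n := by omega
  have hidle : checkPolicy x x₃ n ⟨e + (x - 1), hlast⟩ = SourceAction.idle := by
    have hmono := sectionEnd_strictMono hx x₃
    have hu : ¬ IsUserSlot x x₃ n (e + (x - 1)) := by
      rintro ⟨m, hm, h⟩
      have : sectionEnd x x₃ (m * x₃) ≤ e := hmono.monotone (by
        rw [mul_comm x₃]; exact Nat.mul_le_mul_right _ (Finset.mem_Icc.1 hm).2)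
      omega
    have hc : ¬ IsCacheSlot x x₃ n (e + (x - 1)) := by
      rintro ⟨m, hm, h⟩
      have : sectionEnd x x₃ m ≤ e := hmono.monotone (Finset.mem_Icc.1 hm).2
      omega
    simp [checkPolicy, hu, hc]
  have hend := corrSum_idle hlast hidle
  rw [show e + (x - 1) + 1 = e + x by omega, hrun.1, hrun.2, h3] at hend
  have hcost := checkCost_le hx hx₃ n
  rw [mul_comm n x₃] at hcost
  rw [show Finset.range (horizon x x₃ n) = Finset.range (e + x) by rw [hT]]
  push_cast [hx] at hend
  rw [hend] at key
  linarith

/-! ### The age under `offlineCheckPolicy` -/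

theorem isDelayedCacheSlot_congr {x x₃ n T : ℕ} {σ σ' : AdvSeq T} {t : Fin T}
    (h : ∀ s ≤ t, σ s = σ' s) (hd : IsDelayedCacheSlot x x₃ n σ t) :
    IsDelayedCacheSlot x x₃ n σ' t := by
  obtain ⟨i, hi, h1, h2, h3, h4⟩ := hd
  refine ⟨i, hi, h1, h2, fun s hs hst => ?_, ?_⟩
  · rw [← h s hst.le]; exact h3 s hs hst
  · rw [← h t le_rfl]; exact h4

theorem offlineCheckPolicy_congr {x x₃ n : ℕ} {σ σ' : AdvSeq (horizon x x₃ n)}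
    {t : Fin (horizon x x₃ n)} (h : ∀ s ≤ t, σ s = σ' s) :
    offlineCheckPolicy x x₃ n σ t = offlineCheckPolicy x x₃ n σ' t := by
  have : IsDelayedCacheSlot x x₃ n σ t ↔ IsDelayedCacheSlot x x₃ n σ' t :=
    ⟨isDelayedCacheSlot_congr h, isDelayedCacheSlot_congr fun s hs => (h s hs).symm⟩
  simp only [offlineCheckPolicy, this]

/-- The packets held by user and cache under `offlineCheckPolicy`. -/
def offPackets (x x₃ n : ℕ) (σ : AdvSeq (horizon x x₃ n)) (t : ℕ) : ℤ × ℤ :=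
  packets (offlineCheckPolicy x x₃ n σ) σ t

theorem offPackets_flipAt {x x₃ n : ℕ} (σ : AdvSeq (horizon x x₃ n)) {t : ℕ}
    {s : Fin (horizon x x₃ n)} (h : t ≤ s) :
    offPackets x x₃ n (flipAt s σ) t = offPackets x x₃ n σ t := by
  have hflip : ∀ r : Fin (horizon x x₃ n), (r : ℕ) < t → flipAt s σ r = σ r := fun r hr =>
    flipAt_of_ne (by intro e; subst e; omega) σ
  exact packets_congr t
    (fun r hr => offlineCheckPolicy_congr fun r' hr' => hflip r' (lt_of_le_of_lt hr' hr)) hflip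

/-- The adversary has not forwarded the cached packet since the window of section `i` began. -/
def Quiet (x x₃ i : ℕ) {T : ℕ} (σ : AdvSeq T) (t : ℕ) : Prop :=
  ∀ s : Fin T, sectionEnd x x₃ i ≤ (s : ℕ) + 1 → (s : ℕ) < t → σ s = false

instance (x x₃ i : ℕ) {T : ℕ} (σ : AdvSeq T) (t : ℕ) : Decidable (Quiet x x₃ i σ t) := by
  unfold Quiet; infer_instance

theorem quiet_start {x x₃ i T : ℕ} (σ : AdvSeq T) {t : ℕ} (h : t + 1 ≤ sectionEnd x x₃ i) :
    Quiet x x₃ i σ t := fun s h1 h2 => by omega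

theorem quiet_succ {x x₃ i T : ℕ} (σ : AdvSeq T) {t : ℕ} (ht : t < T)
    (h : sectionEnd x x₃ i ≤ t + 1) :
    Quiet x x₃ i σ (t + 1) ↔ Quiet x x₃ i σ t ∧ σ ⟨t, ht⟩ = false := by
  constructor
  · exact fun hq => ⟨fun s h1 h2 => hq s h1 (by omega), hq ⟨t, ht⟩ h (by simp)⟩
  · rintro ⟨h1, h2⟩ s hs hst
    rcases Nat.lt_succ_iff_lt_or_eq.1 hst with h3 | h3
    · exact h1 s hs h3
    · rw [show s = ⟨t, ht⟩ from Fin.ext h3]; exact h2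

theorem quiet_flipAt {x x₃ i T : ℕ} (σ : AdvSeq T) {t : ℕ} {s : Fin T} (h : t ≤ s) :
    Quiet x x₃ i (flipAt s σ) t ↔ Quiet x x₃ i σ t := by
  refine forall_congr' fun r => imp_congr_right fun _ => forall_congr' fun hr => ?_
  rw [flipAt_of_ne (by intro e; subst e; omega) σ]

theorem offlineCheckPolicy_window {x x₃ n t i : ℕ} (hx : 1 ≤ x) (h : t < horizon x x₃ n)
    (hi : i ∈ Finset.Icc 1 (x₃ * n)) (h1 : sectionEnd x x₃ i ≤ t + 1)
    (h2 : t + 1 < sectionEnd x x₃ i + x) (σ : AdvSeq (horizon x x₃ n)) :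
    offlineCheckPolicy x x₃ n σ ⟨t, h⟩ =
      if Quiet x x₃ i σ t ∧ (σ ⟨t, h⟩ = true ∨ t + 2 = sectionEnd x x₃ i + x)
      then SourceAction.cache else SourceAction.idle := by
  have hiff : IsDelayedCacheSlot x x₃ n σ ⟨t, h⟩ ↔
      Quiet x x₃ i σ t ∧ (σ ⟨t, h⟩ = true ∨ t + 2 = sectionEnd x x₃ i + x) := by
    constructor
    · rintro ⟨k, -, k1, k2, k3, k4⟩
      have hmono := sectionEnd_strictMono hx x₃
      have e1 := sectionEnd_add_le x x₃ i
      have e2 := sectionEnd_add_le x x₃ k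
      simp only at k1 k2
      have l1 : k < i + 1 := hmono.lt_iff_lt.1 (by omega)
      have l2 : i < k + 1 := hmono.lt_iff_lt.1 (by omega)
      obtain rfl : k = i := by omega
      exact ⟨fun s hs hst => k3 s hs hst, k4⟩
    · rintro ⟨q1, q2⟩
      exact ⟨i, hi, h1, h2, fun s hs hst => q1 s hs hst, q2⟩
  simp only [offlineCheckPolicy, not_isUserSlot (n := n) hx h1 h2, hiff, if_false]

/-- One slot of a window: only the first forwarded packet matters. -/
theorem offPackets_window_step {x x₃ n t i : ℕ} (hx : 1 ≤ x) (h : t < horizon x x₃ n)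
    (hi : i ∈ Finset.Icc 1 (x₃ * n)) (h1 : sectionEnd x x₃ i ≤ t + 1)
    (h2 : t + 1 < sectionEnd x x₃ i + x) (σ : AdvSeq (horizon x x₃ n))
    (hsync : ¬ Quiet x x₃ i σ t → (offPackets x x₃ n σ t).1 = (offPackets x x₃ n σ t).2) :
    (offPackets x x₃ n σ (t + 1)).1 =
      (if Quiet x x₃ i σ t ∧ σ ⟨t, h⟩ = true then (t : ℤ) else (offPackets x x₃ n σ t).1) ∧
    (¬ Quiet x x₃ i σ (t + 1) →
      (offPackets x x₃ n σ (t + 1)).1 = (offPackets x x₃ n σ (t + 1)).2) := by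
  have hact := offlineCheckPolicy_window hx h hi h1 h2 σ
  rw [quiet_succ σ h h1]
  unfold offPackets at *
  by_cases hq : Quiet x x₃ i σ t
  · by_cases hσ : σ ⟨t, h⟩ = true
    · rw [if_pos ⟨hq, Or.inl hσ⟩] at hact
      rw [packets_cache σ h hact]
      simp [hq, hσ]
    · rw [Bool.not_eq_true] at hσ
      by_cases hl : t + 2 = sectionEnd x x₃ i + x
      · rw [if_pos ⟨hq, Or.inr hl⟩] at hact
        rw [packets_cache σ h hact]
        simp [hq, hσ]
      · rw [if_neg (by simp [hσ, hl])] at hact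
        rw [packets_idle σ h hact]
        simp [hq, hσ]
  · rw [if_neg (by simp [hq])] at hact
    rw [packets_idle σ h hact, hsync hq]
    simp [hq]

theorem offPackets_window {x x₃ n i : ℕ} (hx : 1 ≤ x) (hx₃ : 1 ≤ x₃)
    (hi : i ∈ Finset.Icc 1 (x₃ * n)) (σ : AdvSeq (horizon x x₃ n)) {t₀ : ℕ}
    (ht₀ : t₀ + 1 = sectionEnd x x₃ i) (k : ℕ) (hk : k < x) :
    (¬ Quiet x x₃ i σ (t₀ + k) →
      (offPackets x x₃ n σ (t₀ + k)).1 = (offPackets x x₃ n σ (t₀ + k)).2) ∧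
    (Quiet x x₃ i σ (t₀ + k) →
      (offPackets x x₃ n σ (t₀ + k)).1 = (offPackets x x₃ n σ t₀).1) := by
  induction k with
  | zero => exact ⟨fun h => absurd (quiet_start σ (by omega)) h, fun _ => rfl⟩
  | succ k ih =>
    obtain ⟨ih1, ih2⟩ := ih (by omega)
    have hle : sectionEnd x x₃ i ≤ sectionEnd x x₃ (x₃ * n) :=
      (sectionEnd_strictMono hx x₃).monotone (Finset.mem_Icc.1 hi).2
    have hT := horizon_eq x hx₃ n
    have h : t₀ + k < horizon x x₃ n := by omega
    obtain ⟨s1, s2⟩ := offPackets_window_step hx h hi (by omega) (by omega) σ ih1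
    refine ⟨s2, fun hq => ?_⟩
    rw [← add_assoc] at hq ⊢
    obtain ⟨q1, q2⟩ := (quiet_succ σ h (by omega)).1 hq
    rw [s1, if_neg (by simp [q2]), ih2 q1]

theorem fairExp_quiet {x x₃ i T : ℕ} {t₀ : ℕ} (ht₀ : t₀ + 1 = sectionEnd x x₃ i)
    (g : AdvSeq T → ℝ) (hg : ∀ s : Fin T, t₀ ≤ s → ∀ σ, g (flipAt s σ) = g σ) (k : ℕ)
    (hk : t₀ + k ≤ T) :
    fairExp (fun σ => if Quiet x x₃ i σ (t₀ + k) then g σ else 0) = (1 / 2) ^ k * fairExp g := by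
  induction k with
  | zero =>
    simp [quiet_start (x := x) (x₃ := x₃) (i := i) _ ht₀.le]
  | succ k ih =>
    have h : t₀ + k < T := by omega
    have e : (fun σ : AdvSeq T => if Quiet x x₃ i σ (t₀ + (k + 1)) then g σ else 0) =
        fun σ => if σ ⟨t₀ + k, h⟩ = true then (0 : ℝ)
          else if Quiet x x₃ i σ (t₀ + k) then g σ else 0 := by
      ext σ
      have hs := quiet_succ (x := x) (x₃ := x₃) (i := i) σ h (by omega)
      rw [← add_assoc]
      simp only [hs]
      cases σ ⟨t₀ + k, h⟩ <;> simp
    rw [e, fairExp_ite _ _ _ (fun _ => rfl) (fun σ => ?_), fairExp_const, ih (by omega), pow_succ]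
    · ring
    · simp only [quiet_flipAt (x := x) (x₃ := x₃) (i := i) σ
        (show t₀ + k ≤ ((⟨t₀ + k, h⟩ : Fin T) : ℕ) from le_rfl),
        hg ⟨t₀ + k, h⟩ (Nat.le_add_right _ _)]

/-- Expected age of the user before slot `t` under `offlineCheckPolicy`. -/
noncomputable def offExpAge (x x₃ n t : ℕ) : ℝ :=
  fairExp fun σ => (t : ℝ) - ((offPackets x x₃ n σ t).1 : ℝ)

theorem offExpAge_window_step {x x₃ n i : ℕ} (hx : 1 ≤ x) (hx₃ : 1 ≤ x₃)
    (hi : i ∈ Finset.Icc 1 (x₃ * n)) {t₀ : ℕ} (ht₀ : t₀ + 1 = sectionEnd x x₃ i) (k : ℕ)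
    (hk : k < x) :
    offExpAge x x₃ n (t₀ + k + 1) = offExpAge x x₃ n (t₀ + k) + 1
      - (1 / 2) ^ (k + 1) * (offExpAge x x₃ n t₀ + k) := by
  have hle : sectionEnd x x₃ i ≤ sectionEnd x x₃ (x₃ * n) :=
    (sectionEnd_strictMono hx x₃).monotone (Finset.mem_Icc.1 hi).2
  have hT := horizon_eq x hx₃ n
  have h : t₀ + k < horizon x x₃ n := by omega
  set g : AdvSeq (horizon x x₃ n) → ℝ :=
    fun σ => ((t₀ : ℝ) - ((offPackets x x₃ n σ t₀).1 : ℝ)) + k with hg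
  have hginv : ∀ s : Fin (horizon x x₃ n), t₀ ≤ s → ∀ σ, g (flipAt s σ) = g σ := by
    intro s hs σ
    simp only [hg, offPackets_flipAt σ hs]
  have e : (fun σ => ((t₀ + k + 1 : ℕ) : ℝ) - ((offPackets x x₃ n σ (t₀ + k + 1)).1 : ℝ)) =
      fun σ => ((((t₀ + k : ℕ) : ℝ) - ((offPackets x x₃ n σ (t₀ + k)).1 : ℝ)) + 1) +
        (-1) * (if σ ⟨t₀ + k, h⟩ = true then
          (if Quiet x x₃ i σ (t₀ + k) then g σ else 0) else 0) := by
    ext σ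
    obtain ⟨w1, w2⟩ := offPackets_window hx hx₃ hi σ ht₀ k hk
    obtain ⟨s1, -⟩ := offPackets_window_step hx h hi (by omega) (by omega) σ w1
    rw [s1]
    by_cases hq : Quiet x x₃ i σ (t₀ + k)
    · by_cases hσ : σ ⟨t₀ + k, h⟩ = true
      · simp only [hq, hσ, and_self, if_true, hg, w2 hq]
        push_cast; ring
      · rw [if_neg hσ, if_neg fun hc => hσ hc.2]
        push_cast; ring
    · simp only [hq, false_and, if_false, ite_self]
      push_cast; ring
  unfold offExpAge
  rw [e, fairExp_add, fairExp_add, fairExp_const, fairExp_const_mul,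
    fairExp_ite _ _ _ (fun σ => ?_) (fun _ => rfl), fairExp_const,
    fairExp_quiet ht₀ g hginv k h.le, pow_succ]
  · simp only [hg, fairExp_add, fairExp_const]
    ring
  · simp only [quiet_flipAt (x := x) (x₃ := x₃) (i := i) σ
        (show t₀ + k ≤ ((⟨t₀ + k, h⟩ : Fin _) : ℕ) from le_rfl),
        hginv ⟨t₀ + k, h⟩ (Nat.le_add_right _ _)]

/-- Accumulated expected age before slot `t` under `offlineCheckPolicy`. -/
noncomputable def offExpSum (x x₃ n t : ℕ) : ℝ := ∑ s ∈ Finset.range t, offExpAge x x₃ n s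

theorem offExpAge_window {x x₃ n i : ℕ} (hx : 1 ≤ x) (hx₃ : 1 ≤ x₃)
    (hi : i ∈ Finset.Icc 1 (x₃ * n)) {t₀ : ℕ} (ht₀ : t₀ + 1 = sectionEnd x x₃ i) (k : ℕ)
    (hk : k ≤ x) :
    offExpAge x x₃ n (t₀ + k) = k - 1 + (1 / 2) ^ k * (offExpAge x x₃ n t₀ + k + 1) ∧
    offExpSum x x₃ n (t₀ + k) = offExpSum x x₃ n t₀ + k * ((k : ℝ) - 3) / 2
      + 2 * (1 - (1 / 2) ^ k) * offExpAge x x₃ n t₀ + 4 - 2 * (1 / 2) ^ k * (k + 2) := by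
  induction k with
  | zero => constructor <;> (simp; try norm_num)
  | succ k ih =>
    obtain ⟨h1, h2⟩ := ih (by omega)
    have hstep := offExpAge_window_step hx hx₃ hi ht₀ k (by omega)
    rw [← add_assoc]
    constructor
    · rw [hstep, h1, pow_succ]; push_cast; ring
    · rw [offExpSum, Finset.sum_range_succ, ← offExpSum, h1, h2, pow_succ]; push_cast; ring

theorem offPackets_start {x x₃ n : ℕ} (hx : 1 ≤ x) (hx₃ : 1 ≤ x₃)
    (σ : AdvSeq (horizon x x₃ n)) (t : ℕ) (ht : t < x) :
    offPackets x x₃ n σ t = (-1, -1) := by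
  induction t with
  | zero => rfl
  | succ t ih =>
    have hT := horizon_eq x hx₃ n
    have h : t < horizon x x₃ n := by omega
    have hu : ¬ IsUserSlot x x₃ n t :=
      not_isUserSlot (i := 0) hx (by rw [sectionEnd_zero]; omega) (by rw [sectionEnd_zero]; omega)
    have hd : ¬ IsDelayedCacheSlot x x₃ n σ ⟨t, h⟩ := by
      rintro ⟨i, hi, h1, -⟩
      have h2 : sectionEnd x x₃ (0 + 1) ≤ sectionEnd x x₃ i :=
        (sectionEnd_strictMono hx x₃).monotone (Finset.mem_Icc.1 hi).1
      have h3 := sectionEnd_add_le x x₃ 0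
      simp only at h1
      omega
    have hact : offlineCheckPolicy x x₃ n σ ⟨t, h⟩ = SourceAction.idle := by
      simp [offlineCheckPolicy, hu, hd]
    have ih' := ih (by omega)
    unfold offPackets at ih' ⊢
    rw [packets_idle σ h hact, ih']
    simp

theorem offExpAge_start {x x₃ n : ℕ} (hx : 1 ≤ x) (hx₃ : 1 ≤ x₃) (t : ℕ) (ht : t < x) :
    offExpAge x x₃ n t = t + 1 ∧ offExpSum x x₃ n t = (t : ℝ) * (t + 1) / 2 := by
  have hage : ∀ s < x, offExpAge x x₃ n s = s + 1 := by
    intro s hs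
    simp only [offExpAge, offPackets_start hx hx₃ _ s hs, fairExp_const]
    push_cast; ring
  refine ⟨hage t ht, ?_⟩
  induction t with
  | zero => simp [offExpSum]
  | succ t ih =>
    have h2 := ih (by omega)
    rw [offExpSum, Finset.sum_range_succ, ← offExpSum, h2, hage t (by omega)]
    push_cast; ring

theorem offExpAge_user {x x₃ n t i : ℕ} (h : t < horizon x x₃ n)
    (hd : x₃ ∣ i + 1) (hi : i + 1 ≤ x₃ * n) (ht : t + 2 = sectionEnd x x₃ (i + 1)) :
    offExpAge x x₃ n (t + 1) = 1 := by
  have hu := isUserSlot_of_dvd hd hi ht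
  have hact : ∀ σ, offlineCheckPolicy x x₃ n σ ⟨t, h⟩ = SourceAction.user := by
    intro σ; simp [offlineCheckPolicy, hu]
  simp only [offExpAge, offPackets, packets_user _ h (hact _)]
  push_cast
  simp [fairExp_const]

/-- Expected age under `offlineCheckPolicy` at the end of the window of section `i`. -/
noncomputable def postAge (x x₃ : ℕ) : ℕ → ℝ
  | 0 => x
  | i + 1 => x - 1 + (1 / 2) ^ x * ((if x₃ ∣ i + 1 then 1 else postAge x x₃ i) + x + 1)

/-- Accumulated expected age under `offlineCheckPolicy` at the end of the window of section `i`. -/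
noncomputable def postSum (x x₃ : ℕ) : ℕ → ℝ
  | 0 => (x : ℝ) * (x - 1) / 2
  | i + 1 => postSum x x₃ i + (if x₃ ∣ i + 1 then postAge x x₃ i else 0)
      + x * ((x : ℝ) - 3) / 2
      + 2 * (1 - (1 / 2) ^ x) * (if x₃ ∣ i + 1 then 1 else postAge x x₃ i)
      + 4 - 2 * (1 / 2) ^ x * (x + 2)

theorem offExpAge_section {x x₃ n : ℕ} (hx : 1 ≤ x) (hx₃ : 1 ≤ x₃) (i : ℕ)
    (hi : i ≤ x₃ * n) :
    offExpAge x x₃ n (sectionEnd x x₃ i + (x - 1)) = postAge x x₃ i ∧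
    offExpSum x x₃ n (sectionEnd x x₃ i + (x - 1)) = postSum x x₃ i := by
  induction i with
  | zero =>
    obtain ⟨h1, h2⟩ := offExpAge_start (n := n) hx hx₃ (x - 1) (by omega)
    rw [sectionEnd_zero, zero_add, h1, h2]
    push_cast [hx]
    constructor
    · simp [postAge]
    · simp only [postSum]; ring
  | succ i ih =>
    obtain ⟨h1, h2⟩ := ih (by omega)
    have hmem : i + 1 ∈ Finset.Icc 1 (x₃ * n) := Finset.mem_Icc.2 ⟨by omega, hi⟩
    have hs := sectionEnd_succ x x₃ i
    have hle : sectionEnd x x₃ (i + 1) ≤ sectionEnd x x₃ (x₃ * n) :=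
      (sectionEnd_strictMono hx x₃).monotone hi
    have hT := horizon_eq x hx₃ n
    set t := sectionEnd x x₃ i + (x - 1) with ht
    by_cases hd : x₃ ∣ i + 1
    · rw [if_pos hd] at hs
      have hu := offExpAge_user (x := x) (n := n) (t := t) (by omega) hd hi (by omega)
      obtain ⟨w1, w2⟩ := offExpAge_window hx hx₃ hmem (by omega : t + 1 + 1 = _) x le_rfl
      have hsum : offExpSum x x₃ n (t + 1) = postSum x x₃ i + postAge x x₃ i := by
        rw [offExpSum, Finset.sum_range_succ, ← offExpSum, h1, h2]
      have e : sectionEnd x x₃ (i + 1) + (x - 1) = t + 1 + x := by omega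
      rw [e, w1, w2, hu, hsum]
      constructor
      · simp only [postAge, if_pos hd]
      · simp only [postSum, if_pos hd]
    · rw [if_neg hd] at hs
      obtain ⟨w1, w2⟩ := offExpAge_window hx hx₃ hmem (by omega : t + 1 = _) x le_rfl
      have e : sectionEnd x x₃ (i + 1) + (x - 1) = t + x := by omega
      rw [e, w1, w2, h1, h2]
      constructor
      · simp only [postAge, if_neg hd]
      · simp only [postSum, if_neg hd]; ring

/-! ### The closed form -/

/-- Fixed point of the recursion of `postAge`. -/
noncomputable def offStatAge (x : ℕ) : ℝ := x - 1 + 2 * ((1 / 2) ^ x * statAge x)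

theorem offStatAge_eq {x : ℕ} (hx : 1 ≤ x) :
    offStatAge x = x - 1 + (1 / 2) ^ x * (offStatAge x + x + 1) := by
  have h := statAge_eq hx
  have h' : (1 / 2 : ℝ) ^ x * statAge x
      = (1 / 2) ^ x * x + (1 / 2) ^ x * ((1 / 2) ^ x * statAge x) := by
    rw [← mul_add, ← h]
  rw [offStatAge]
  linarith

theorem offlineConst_eq {x : ℕ} (hx : 1 ≤ x) (x₃ : ℕ) :
    offlineConst x x₃ = x₃ * (x * ((x : ℝ) - 3) / 2 + 2 + 2 * x - 2 * (1 / 2) ^ x) + 2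
      - offStatAge x + ((1 / 2) ^ x) ^ x₃ * (offStatAge x - 1) := by
  have h2 : (1 : ℝ) < 2 ^ x := one_lt_pow₀ (by norm_num) (by omega)
  have h2' : (2 : ℝ) ^ x - 1 ≠ 0 := by linarith
  have e1 : offStatAge x = x - 1 + 2 * (x / (2 ^ x - 1)) := by
    rw [offStatAge, statAge, one_div, inv_pow]
    field_simp
  have e2 : ((1 / 2 : ℝ) ^ x) ^ x₃ = 1 / 2 ^ (x * x₃) := by
    rw [← pow_mul, one_div, inv_pow, one_div]
  have e3 : (1 / 2 : ℝ) ^ x = 1 / 2 ^ x := by rw [one_div, inv_pow, one_div]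
  rw [offlineConst, e2, e3, e1]
  field_simp
  ring

theorem offlineConst_pos {x x₃ : ℕ} (hx : 1 ≤ x) (hx₃ : 1 ≤ x₃) : 0 < offlineConst x x₃ := by
  have hq0 : (0 : ℝ) < (1 / 2) ^ x := by positivity
  have hqh : (1 / 2 : ℝ) ^ x ≤ 1 / 2 := half_pow_le_half hx
  have hx' : (1 : ℝ) ≤ x := by exact_mod_cast hx
  have hx₃' : (1 : ℝ) ≤ x₃ := by exact_mod_cast hx₃
  have hys := statAge_eq hx
  have hqys : (1 / 2 : ℝ) ^ x * statAge x ≤ 1 := by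
    have h1 := mul_half_pow_le x
    have h2 : (1 / 2 : ℝ) ^ x * statAge x * (1 - (1 / 2) ^ x) ≤ 1 * (1 - (1 / 2) ^ x) := by
      have : statAge x * (1 - (1 / 2) ^ x) = x := by linarith
      rw [mul_assoc, this]; linarith
    exact le_of_mul_le_mul_right h2 (by linarith)
  have hqys2 : (1 / 2 : ℝ) ^ x * x ≤ (1 / 2 : ℝ) ^ x * statAge x := by
    refine mul_le_mul_of_nonneg_left ?_ hq0.le
    have := mul_nonneg hq0.le (zero_le_one.trans (one_le_statAge hx))
    linarith
  have hs1 : 0 ≤ offStatAge x - 1 := by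
    rcases Nat.eq_or_lt_of_le hx with h | h
    · subst h
      have := statAge_eq (x := 1) le_rfl
      simp only [offStatAge]
      norm_num at this ⊢
      linarith
    · have : (2 : ℝ) ≤ x := by exact_mod_cast h
      rw [offStatAge]
      have := mul_nonneg hq0.le (zero_le_one.trans (one_le_statAge hx))
      linarith
  have hs2 : offStatAge x ≤ x + 1 := by rw [offStatAge]; linarith
  have h3 : (0 : ℝ) ≤ ((1 / 2) ^ x) ^ x₃ * (offStatAge x - 1) := mul_nonneg (by positivity) hs1
  have hc : x * ((x : ℝ) - 3) / 2 + 2 + 2 * x - 2 * (1 / 2) ^ x ≥ (x : ℝ) := by nlinarith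
  have h4 := mul_le_mul_of_nonneg_right hx₃' (le_trans (by linarith) hc :
    0 ≤ x * ((x : ℝ) - 3) / 2 + 2 + 2 * x - 2 * (1 / 2) ^ x)
  rw [offlineConst_eq hx]
  nlinarith

theorem postAge_block {x x₃ : ℕ} (hx : 1 ≤ x) (hx₃ : 1 ≤ x₃) (m r : ℕ) (hr : r < x₃) :
    postAge x x₃ ((m + 1) * x₃ + r)
      = offStatAge x - ((1 / 2) ^ x) ^ (r + 1) * (offStatAge x - 1) ∧
    postSum x x₃ ((m + 1) * x₃ + r) = postSum x x₃ ((m + 1) * x₃)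
      + r * (x * ((x : ℝ) - 3) / 2 + 4 - 2 * (1 / 2) ^ x * (x + 2)
        + 2 * (1 - (1 / 2) ^ x) * offStatAge x)
      - 2 * (offStatAge x - 1) * ((1 / 2) ^ x - ((1 / 2) ^ x) ^ (r + 1)) := by
  have hs := offStatAge_eq hx
  induction r with
  | zero =>
    obtain ⟨k, hk⟩ : ∃ k, (m + 1) * x₃ = k + 1 :=
      Nat.exists_eq_add_of_le' (Nat.mul_pos (Nat.succ_pos m) hx₃)
    have hd : x₃ ∣ k + 1 := hk ▸ Dvd.intro_left (m + 1) rfl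
    constructor
    · rw [add_zero, hk, postAge, if_pos hd, zero_add, pow_one]; linarith
    · simp
  | succ r ih =>
    obtain ⟨h1, h2⟩ := ih (by omega)
    have hd : ¬ x₃ ∣ (m + 1) * x₃ + r + 1 :=
      not_dvd_mul_add (m := m + 1) (r := r + 1) (by omega) hr
    rw [← add_assoc]
    constructor
    · rw [postAge, if_neg hd, h1, pow_succ _ (r + 1)]; linarith
    · rw [postSum, if_neg hd, if_neg hd, h1, h2, pow_succ _ (r + 1)]; push_cast; ring

theorem postSum_block {x x₃ : ℕ} (hx : 1 ≤ x) (hx₃ : 1 ≤ x₃) (m : ℕ) :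
    postSum x x₃ ((m + 1 + 1) * x₃) = postSum x x₃ ((m + 1) * x₃) + offlineConst x x₃ := by
  have hs := offStatAge_eq hx
  obtain ⟨r, rfl⟩ := Nat.exists_eq_add_of_le' hx₃
  obtain ⟨h1, h2⟩ := postAge_block hx hx₃ m r (Nat.lt_succ_self r)
  have e : (m + 1 + 1) * (r + 1) = (m + 1) * (r + 1) + r + 1 := by ring
  have hd : (r + 1) ∣ (m + 1) * (r + 1) + r + 1 := e ▸ Dvd.intro_left (m + 1 + 1) rfl
  rw [e, postSum, if_pos hd, if_pos hd, h1, h2, offlineConst_eq hx]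
  have hr : (r : ℝ) * offStatAge x = r * (x - 1 + (1 / 2) ^ x * (offStatAge x + x + 1)) := by
    rw [← hs]
  push_cast
  linarith

theorem postSum_mul {x x₃ : ℕ} (hx : 1 ≤ x) (hx₃ : 1 ≤ x₃) (m : ℕ) :
    postSum x x₃ ((m + 1) * x₃) = postSum x x₃ x₃ + m * offlineConst x x₃ := by
  induction m with
  | zero => simp
  | succ m ih => rw [postSum_block hx hx₃, ih]; push_cast; ring

theorem offExpSum_horizon {x x₃ : ℕ} (hx : 1 ≤ x) (hx₃ : 1 ≤ x₃) :
    ∃ K : ℝ, ∀ n : ℕ, 1 ≤ n →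
      offExpSum x x₃ n (horizon x x₃ n) = n * offlineConst x x₃ + K := by
  refine ⟨postSum x x₃ x₃ - offlineConst x x₃
    + (offStatAge x - (1 / 2) ^ x * (offStatAge x - 1)), fun n hn => ?_⟩
  obtain ⟨m, rfl⟩ := Nat.exists_eq_add_of_le' hn
  obtain ⟨h1, h2⟩ := offExpAge_section (n := m + 1) hx hx₃ (x₃ * (m + 1)) le_rfl
  have hb := (postAge_block hx hx₃ m 0 (by omega)).1
  rw [add_zero, zero_add, pow_one, mul_comm] at hb
  have hT : horizon x x₃ (m + 1) = sectionEnd x x₃ (x₃ * (m + 1)) + (x - 1) + 1 := by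
    rw [horizon_eq x hx₃]; omega
  rw [hT, offExpSum, Finset.sum_range_succ, ← offExpSum, h1, h2, hb, mul_comm x₃,
    postSum_mul hx hx₃]
  push_cast; ring

theorem fairExp_avgAge_offlineCheckPolicy (x x₃ n : ℕ) :
    fairExp (fun σ => avgAge (offlineCheckPolicy x x₃ n σ) σ)
      = 1 / (horizon x x₃ n : ℝ) * offExpSum x x₃ n (horizon x x₃ n) := by
  unfold avgAge
  rw [fairExp_const_mul, fairExp_sum, offExpSum, ← Fin.sum_univ_eq_sum_range]
  simp [offExpAge, age, offPackets]

/-! ### Asymptotics -/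

theorem horizon_pos {x : ℕ} (hx : 1 ≤ x) (x₃ n : ℕ) : 0 < horizon x x₃ n := by
  have : 0 < x * (x₃ * n + 1) := Nat.mul_pos hx (Nat.succ_pos _)
  rw [horizon]; omega

theorem tendsto_const_div_horizon (x x₃ : ℕ) (K : ℝ) :
    Tendsto (fun n : ℕ => K / (horizon x x₃ n : ℝ)) atTop (𝓝 0) := by
  have h : Tendsto (fun n : ℕ => horizon x x₃ n) atTop atTop :=
    tendsto_atTop_mono (fun _ => Nat.le_add_right _ _) tendsto_id
  exact (tendsto_const_div_atTop_nhds_zero_nat K).comp h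

theorem bestDetAge_ge {x x₃ : ℕ} (hx : 1 ≤ x) (hx₃ : 1 ≤ x₃) :
    ∃ K : ℝ, ∀ n : ℕ, (n * onlineConst x x₃ - K) / (horizon x x₃ n : ℝ)
      ≤ bestDetAge (horizon x x₃ n) n (x₃ * n) := by
  obtain ⟨K, hK⟩ := sum_expAge_ge_onlineConst hx hx₃
  refine ⟨K, fun n => le_ciInf fun p => ?_⟩
  rw [fairExp_avgAge, one_div, inv_mul_eq_div]
  gcongr
  exact hK n p.1 p.2

theorem fairExp_checkPolicy_le {x x₃ : ℕ} (hx : 1 ≤ x) (hx₃ : 1 ≤ x₃) :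
    ∃ K : ℝ, ∀ n : ℕ, fairExp (avgAge (checkPolicy x x₃ n))
      ≤ (n * onlineConst x x₃ + K) / (horizon x x₃ n : ℝ) := by
  obtain ⟨K, hK⟩ := sum_expAge_checkPolicy_le hx hx₃
  refine ⟨K, fun n => ?_⟩
  rw [fairExp_avgAge, one_div, inv_mul_eq_div]
  gcongr
  exact hK n

theorem fairExp_offlineCheckPolicy_eq {x x₃ : ℕ} (hx : 1 ≤ x) (hx₃ : 1 ≤ x₃) :
    ∃ K : ℝ, ∀ n : ℕ, 1 ≤ n → fairExp (fun σ => avgAge (offlineCheckPolicy x x₃ n σ) σ)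
      = (n * offlineConst x x₃ + K) / (horizon x x₃ n : ℝ) := by
  obtain ⟨K, hK⟩ := offExpSum_horizon hx hx₃
  refine ⟨K, fun n hn => ?_⟩
  rw [fairExp_avgAge_offlineCheckPolicy, one_div, inv_mul_eq_div, hK n hn]

theorem tendsto_checkPolicy_sub_bestDetAge {x x₃ : ℕ} (hx : 1 ≤ x) (hx₃ : 1 ≤ x₃) :
    Tendsto (fun n : ℕ => fairExp (avgAge (checkPolicy x x₃ n))
      - bestDetAge (horizon x x₃ n) n (x₃ * n)) atTop (𝓝 0) := by
  obtain ⟨K₁, h₁⟩ := bestDetAge_ge hx hx₃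
  obtain ⟨K₂, h₂⟩ := fairExp_checkPolicy_le hx hx₃
  refine squeeze_zero (fun n => sub_nonneg.2 (bestDetAge_le (feasible_checkPolicy hx hx₃ n)))
    (fun n => ?_) (tendsto_const_div_horizon x x₃ (K₁ + K₂))
  calc _ ≤ (n * onlineConst x x₃ + K₂) / (horizon x x₃ n : ℝ)
        - (n * onlineConst x x₃ - K₁) / (horizon x x₃ n : ℝ) := sub_le_sub (h₂ n) (h₁ n)
    _ = _ := by ring

theorem tendsto_checkPolicy_sub_onlineConst {x x₃ : ℕ} (hx : 1 ≤ x) (hx₃ : 1 ≤ x₃) :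
    Tendsto (fun n : ℕ => fairExp (avgAge (checkPolicy x x₃ n))
      - (n : ℝ) / (horizon x x₃ n : ℝ) * onlineConst x x₃) atTop (𝓝 0) := by
  obtain ⟨K₁, h₁⟩ := bestDetAge_ge hx hx₃
  obtain ⟨K₂, h₂⟩ := fairExp_checkPolicy_le hx hx₃
  refine tendsto_of_tendsto_of_tendsto_of_le_of_le (tendsto_const_div_horizon x x₃ (-K₁))
    (tendsto_const_div_horizon x x₃ K₂) (fun n => ?_) (fun n => ?_)
  · have h := (h₁ n).trans (bestDetAge_le (feasible_checkPolicy hx hx₃ n))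
    have e : (n * onlineConst x x₃ - K₁) / (horizon x x₃ n : ℝ)
        = (n : ℝ) / (horizon x x₃ n : ℝ) * onlineConst x x₃ + -K₁ / (horizon x x₃ n : ℝ) := by
      ring
    simp only
    linarith
  · have h := h₂ n
    have e : (n * onlineConst x x₃ + K₂) / (horizon x x₃ n : ℝ)
        = (n : ℝ) / (horizon x x₃ n : ℝ) * onlineConst x x₃ + K₂ / (horizon x x₃ n : ℝ) := by
      ring
    simp only
    linarith

theorem tendsto_offlineCheckPolicy_sub_offlineConst {x x₃ : ℕ} (hx : 1 ≤ x) (hx₃ : 1 ≤ x₃) :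
    Tendsto (fun n : ℕ => fairExp (fun σ => avgAge (offlineCheckPolicy x x₃ n σ) σ)
      - (n : ℝ) / (horizon x x₃ n : ℝ) * offlineConst x x₃) atTop (𝓝 0) := by
  obtain ⟨K, hK⟩ := fairExp_offlineCheckPolicy_eq hx hx₃
  refine (tendsto_const_div_horizon x x₃ K).congr' ?_
  filter_upwards [eventually_ge_atTop 1] with n hn
  rw [hK n hn]
  ring

theorem fairExp_offlineAge_le {x x₃ : ℕ} (hx : 1 ≤ x) (hx₃ : 1 ≤ x₃) (n : ℕ) :
    fairExp (offlineAge (T := horizon x x₃ n) n (x₃ * n))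
      ≤ fairExp (fun σ => avgAge (offlineCheckPolicy x x₃ n σ) σ) :=
  fairExp_mono fun σ => offlineAge_le (feasible_offlineCheckPolicy hx hx₃ n σ) σ

theorem one_le_bestDetAge {T : ℕ} (hT : 0 < T) (T₁ T₂ : ℕ) : 1 ≤ bestDetAge T T₁ T₂ := by
  refine le_ciInf fun p => ?_
  rw [← fairExp_const (T := T) 1]
  exact fairExp_mono fun σ => one_le_avgAge hT p.1 σ

theorem tendsto_affine_div_affine {N D : ℝ} (hD : D ≠ 0) (K K' : ℝ) :
    Tendsto (fun n : ℕ => (n * N - K) / (n * D + K')) atTop (𝓝 (N / D)) := by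
  have h : Tendsto (fun n : ℕ => (N - K / n) / (D + K' / n)) atTop
      (𝓝 ((N - 0) / (D + 0))) :=
    (tendsto_const_nhds.sub (tendsto_const_div_atTop_nhds_zero_nat K)).div
      (tendsto_const_nhds.add (tendsto_const_div_atTop_nhds_zero_nat K')) (by simpa using hD)
  rw [sub_zero, add_zero] at h
  refine h.congr' ?_
  filter_upwards [eventually_ge_atTop 1] with n hn
  have hn' : (n : ℝ) ≠ 0 := by positivity
  rw [← mul_div_mul_left _ _ hn']
  congr 1 <;> field_simp

/-- The lower bound on the ratio of the best schedule to the offline optimum. -/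
theorem eventually_onlineConst_div_offlineConst_le {x x₃ : ℕ} (hx : 1 ≤ x) (hx₃ : 1 ≤ x₃)
    {ε : ℝ} (hε : 0 < ε) : ∀ᶠ n : ℕ in atTop,
      onlineConst x x₃ / offlineConst x x₃ - ε
        ≤ bestDetAge (horizon x x₃ n) n (x₃ * n)
          / fairExp (offlineAge (T := horizon x x₃ n) n (x₃ * n)) := by
  obtain ⟨K₁, h₁⟩ := bestDetAge_ge hx hx₃
  obtain ⟨K₂, h₂⟩ := fairExp_offlineCheckPolicy_eq hx hx₃
  have hlim := tendsto_affine_div_affine (N := onlineConst x x₃)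
    (offlineConst_pos hx hx₃).ne' K₁ K₂
  filter_upwards [hlim.eventually_const_le (sub_lt_self _ hε), eventually_ge_atTop 1] with n hn h1n
  refine hn.trans ?_
  have hT : (0 : ℝ) < horizon x x₃ n := by exact_mod_cast horizon_pos hx x₃ n
  have hoff := fairExp_offlineAge_le hx hx₃ n
  rw [h₂ n h1n] at hoff
  have hoff1 := one_le_fairExp_offlineAge (horizon_pos hx x₃ n) n (x₃ * n)
  have hbest := one_le_bestDetAge (horizon_pos hx x₃ n) n (x₃ * n)
  have hden : 0 < (n * offlineConst x x₃ + K₂) / (horizon x x₃ n : ℝ) := by linarith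
  calc (n * onlineConst x x₃ - K₁) / (n * offlineConst x x₃ + K₂)
      = ((n * onlineConst x x₃ - K₁) / (horizon x x₃ n : ℝ))
        / ((n * offlineConst x x₃ + K₂) / (horizon x x₃ n : ℝ)) :=
        (div_div_div_cancel_right₀ hT.ne' _ _).symm
    _ ≤ bestDetAge (horizon x x₃ n) n (x₃ * n)
        / ((n * offlineConst x x₃ + K₂) / (horizon x x₃ n : ℝ)) :=
        div_le_div_of_nonneg_right (h₁ n) hden.le
    _ ≤ _ := div_le_div_of_nonneg_left (by linarith) (by linarith) hoff

end CacheAge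

open CacheAge in
theorem mainTheorem2 (x₂ x₃ : ℕ) (hx₂ : 1 ≤ x₂) (hx₃ : 1 ≤ x₃) :
    -- every randomized policy, every horizon: Yao's bound for the uniform adversary
    (∀ T T₁ T₂ : ℕ, T₁ + T₂ < T → ∀ π : PMF (Schedule T),
      (∀ p ∈ π.support, Feasible T₁ T₂ p) →
        bestDetAge T T₁ T₂ / fairExp (offlineAge (T := T) T₁ T₂) ≤ competitiveRatio T₁ T₂ π) ∧
    -- `checkPolicy` is admissible and asymptotically the best deterministic policy
    (∀ n : ℕ, Feasible n (x₃ * n) (checkPolicy x₂ x₃ n)) ∧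
    Tendsto (fun n : ℕ => fairExp (avgAge (checkPolicy x₂ x₃ n))
        - bestDetAge (horizon x₂ x₃ n) n (x₃ * n)) atTop (𝓝 0) ∧
    -- its expected average age
    Tendsto (fun n : ℕ => fairExp (avgAge (checkPolicy x₂ x₃ n))
        - (n : ℝ) / (horizon x₂ x₃ n : ℝ) * onlineConst x₂ x₃) atTop (𝓝 0) ∧
    -- the auxiliary offline policy and the upper bound on the offline optimum
    (∀ (n : ℕ) (σ : AdvSeq (horizon x₂ x₃ n)),
      Feasible n (x₃ * n) (offlineCheckPolicy x₂ x₃ n σ)) ∧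
    Tendsto (fun n : ℕ => fairExp (fun σ => avgAge (offlineCheckPolicy x₂ x₃ n σ) σ)
        - (n : ℝ) / (horizon x₂ x₃ n : ℝ) * offlineConst x₂ x₃) atTop (𝓝 0) ∧
    (∀ ε : ℝ, 0 < ε → ∀ᶠ n : ℕ in atTop,
      fairExp (offlineAge (T := horizon x₂ x₃ n) n (x₃ * n))
        ≤ (n : ℝ) / (horizon x₂ x₃ n : ℝ) * offlineConst x₂ x₃ + ε) ∧
    -- the universal lower bound on the competitive ratio
    0 < offlineConst x₂ x₃ ∧
    (∀ ε : ℝ, 0 < ε → ∀ᶠ n : ℕ in atTop, ∀ π : PMF (Schedule (horizon x₂ x₃ n)),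
      (∀ p ∈ π.support, Feasible n (x₃ * n) p) →
        fairExp (avgAge (checkPolicy x₂ x₃ n))
            / fairExp (offlineAge (T := horizon x₂ x₃ n) n (x₃ * n)) - ε
          ≤ competitiveRatio n (x₃ * n) π ∧
        onlineConst x₂ x₃ / offlineConst x₂ x₃ - ε ≤ competitiveRatio n (x₃ * n) π) := by
  refine ⟨fun T T₁ T₂ hT π hπ =>
      bestDetAge_div_le_competitiveRatio (by omega) T₁ T₂ π hπ,
    feasible_checkPolicy hx₂ hx₃, tendsto_checkPolicy_sub_bestDetAge hx₂ hx₃,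
    tendsto_checkPolicy_sub_onlineConst hx₂ hx₃, feasible_offlineCheckPolicy hx₂ hx₃,
    tendsto_offlineCheckPolicy_sub_offlineConst hx₂ hx₃, fun ε hε => ?_,
    offlineConst_pos hx₂ hx₃, fun ε hε => ?_⟩
  · filter_upwards [(tendsto_offlineCheckPolicy_sub_offlineConst hx₂ hx₃).eventually_le_const hε]
      with n hn
    linarith [fairExp_offlineAge_le hx₂ hx₃ n]
  · filter_upwards [(tendsto_checkPolicy_sub_bestDetAge hx₂ hx₃).eventually_le_const hε,
      eventually_onlineConst_div_offlineConst_le hx₂ hx₃ hε] with n h1 h2 π hπ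
    have hpos := horizon_pos hx₂ x₃ n
    have hc := bestDetAge_div_le_competitiveRatio hpos n (x₃ * n) π hπ
    refine ⟨le_trans ?_ hc, h2.trans hc⟩
    have hoff := one_le_fairExp_offlineAge hpos n (x₃ * n)
    rw [sub_le_iff_le_add, div_add' _ _ _ (by linarith)]
    refine div_le_div_of_nonneg_right ?_ (by linarith)
    have := mul_le_mul_of_nonneg_left hoff hε.le
    linarith
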